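/- Let $X_1=\frac{\partial}{\partial x}+y'\frac{\partial}{\partial y}+(6y^2+x)\frac{\partial}{\partial y'}$ be the vector field on $\mathbb{C}^3$, with coordinates $(x,y,y')$, associated with the first Painlevé equation $\frac{d^2y}{dx^2}=6y^2+x$. Let $K$ be an algebraic closure of $\mathbb{C}(x,y,y')$, with the unique extensions of $\partial/\partial x,\partial/\partial y,\partial/\partial y'$ to $K$; a $1$-form with algebraic coefficients is an expression $a\,dx+b\,dy+c\,dy'$ with $a,b,c\in K$. A Godbillon–Vey sequence of type $asl_2$ for the foliation given by $X_1$ consists of a vector $\Omega^0=\begin{pmatrix}\omega^0_1\\ \omega^0_2\end{pmatrix}$ of $1$-forms with algebraic coefficients defining the foliation (that is, the vector fields with coefficients in $K$ annihilated by both $\omega^0_1$ and $\omega^0_2$ are exactly the multiples $fX_1$, $f\in K$) and a $2\times2$ matrix $\Omega^1$ of $1$-forms with algebraic coefficients, of trace zero, such that $$d\Omega^0=\Omega^1\wedge\Omega^0\qquad\text{and}\qquad d\Omega^1=\Omega^1\wedge\Omega^1 .$$ Proposition. The foliation given by $X_1$ admits no Godbillon–Vey sequence of type $asl_2$. -/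

import Mathlib

open scoped TensorProduct

noncomputable section

namespace PainleveFoliation

/-- The polynomial ring `ℂ[x, y, y']`; the coordinates `x`, `y`, `y'` have indices `0`, `1`, `2`. -/
abbrev Poly : Type := MvPolynomial (Fin 3) ℂ

/-- The field `ℂ(x, y, y')` of rational functions on `ℂ³`. -/
abbrev RatFun : Type := FractionRing Poly

/-- The field of algebraic functions on `ℂ³`, an algebraic closure of `ℂ(x, y, y')`. -/
abbrev AlgFun : Type := AlgebraicClosure RatFun

instance formallyEtale_algFun : Algebra.FormallyEtale Poly AlgFun :=
  haveI : Algebra.FormallyEtale Poly RatFun :=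
    Algebra.FormallyEtale.of_isLocalization (nonZeroDivisors Poly)
  haveI : Algebra.FormallyEtale RatFun AlgFun := Algebra.FormallyEtale.of_isSeparable _ _
  Algebra.FormallyEtale.comp Poly RatFun AlgFun

/-- The coordinate functions `x`, `y`, `y'` on `ℂ³`, as algebraic functions. -/
def coord (i : Fin 3) : AlgFun := algebraMap Poly AlgFun (MvPolynomial.X i)

/-- The basis `dx`, `dy`, `dy'` of the Kähler differentials of the field of algebraic functions. -/
def diffBasis : Module.Basis (Fin 3) AlgFun (Ω[AlgFun⁄ℂ]) :=
  ((KaehlerDifferential.mvPolynomialBasis ℂ (Fin 3)).baseChange AlgFun).map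
    (KaehlerDifferential.tensorKaehlerEquivOfFormallyEtale ℂ Poly AlgFun)

theorem diffBasis_apply (i : Fin 3) : diffBasis i = KaehlerDifferential.D ℂ AlgFun (coord i) := by
  simp [diffBasis, coord]

/-- The partial derivatives `∂/∂x`, `∂/∂y`, `∂/∂y'` of algebraic functions:
the coefficients in `df = (∂f/∂x) dx + (∂f/∂y) dy + (∂f/∂y') dy'`. -/
def partialDeriv (i : Fin 3) : Derivation ℂ AlgFun AlgFun :=
  (diffBasis.coord i).compDer (KaehlerDifferential.D ℂ AlgFun)

theorem partialDeriv_coord (i j : Fin 3) :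
    partialDeriv i (coord j) = if i = j then 1 else 0 := by
  change diffBasis.coord i (KaehlerDifferential.D ℂ AlgFun (coord j)) = _
  rw [← diffBasis_apply, Module.Basis.coord_apply, Module.Basis.repr_self,
    Finsupp.single_apply]
  simp only [eq_comm]

/-- A 1-form `a dx + b dy + c dy'` on `ℂ³` with algebraic coefficients, given by `(a, b, c)`. -/
abbrev OneForm : Type := Fin 3 → AlgFun

/-- A 2-form `τ` on `ℂ³` with algebraic coefficients, given by the antisymmetric array of its
values `τ i j = τ(∂ᵢ, ∂ⱼ)` on pairs of coordinate vector fields. -/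
abbrev TwoForm : Type := Fin 3 → Fin 3 → AlgFun

/-- A vector field `a ∂/∂x + b ∂/∂y + c ∂/∂y'` on `ℂ³` with algebraic coefficients,
given by `(a, b, c)`. -/
abbrev VectorField : Type := Fin 3 → AlgFun

/-- The value `ω(X)` of a 1-form on a vector field. -/
def contract (ω : OneForm) (X : VectorField) : AlgFun := ∑ i, ω i * X i

/-- The wedge product of two 1-forms. -/
def wedge (ω η : OneForm) : TwoForm := fun i j => ω i * η j - ω j * η i

/-- The exterior derivative of a 1-form. -/
def dForm (ω : OneForm) : TwoForm := fun i j => partialDeriv i (ω j) - partialDeriv j (ω i)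

/-- The 1-forms `Ω⁰₁`, `Ω⁰₂` define the codimension two foliation given by the vector field `X`:
the vector fields annihilated by both forms are exactly the multiples of `X`. -/
def DefinesFoliation (X : VectorField) (Ω₀ : Fin 2 → OneForm) : Prop :=
  ∀ V : VectorField, (∀ i, contract (Ω₀ i) V = 0) ↔ ∃ f : AlgFun, V = f • X

/-- A Godbillon–Vey sequence of type `asl₂` for the foliation given by the vector field `X`. -/
structure IsAslTwoSequence (X : VectorField) (Ω₀ : Fin 2 → OneForm)
    (Ω₁ : Matrix (Fin 2) (Fin 2) OneForm) : Prop where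
  defines : DefinesFoliation X Ω₀
  trace_eq_zero : Ω₁.trace = 0
  structure_zero : ∀ i, dForm (Ω₀ i) = ∑ j, wedge (Ω₁ i j) (Ω₀ j)
  structure_one : ∀ i k, dForm (Ω₁ i k) = ∑ j, wedge (Ω₁ i j) (Ω₁ j k)

/-- The vector field `X₁ = ∂/∂x + y' ∂/∂y + (6 y² + x) ∂/∂y'` of the first Painlevé equation. -/
def painleveOne : VectorField := ![1, coord 2, 6 * coord 1 ^ 2 + coord 0]

end PainleveFoliation

end

/-! In the coframe `dy - y' dx`, `dy' - (6y² + x) dx`, an `asl₂` sequence becomes a flat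
torsion-free connection `G` whose contraction with `X₁` is the matrix of the variational equation
`v'' = 12 y v`. The transverse components of `G`, symmetric by torsion-freeness, contain a binary
cubic form `ω(v, G(v, v))`, with `ω` the area form. Flatness says that its coefficients solve the
linear system `IsCubicSystem` with forcing `12 = ∂²(6y²)/∂y²`. The theorem follows because this
system has no algebraic solution (`not_isCubicSystem_algFun`).

An algebraic solution averages over conjugates to a rational one. The common denominator `g` of a
rational solution divides `X₁ g`, hence is a first integral and then a constant
(`painleveDer_eq_zero_of_dvd`, `exists_eq_C_of_painleveDer_eq_zero`), so the solution is polynomial.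

Give `x, y, y'` the weights `-1, 2, 3`. Then `X₁` is the flow of `y'' = 6y²`, of weight `1`, plus `x
∂/∂y'`, of weight `-4`, and a polynomial solution has a leading part. If that part is unforced,
evaluating the cubic on the variational solutions `y'` and `x y' + 2y` gives homogeneous first
integrals, that is, multiples of powers of the energy `E = y'² - 4y³`. Their weights are consecutive
and `E` has weight `6`, so exactly one is nonzero. At the next order of the perturbation a nonzero
multiple of `E^m y` would have to be a derivative along the flow, which `flow_eq_energy_mul_y`
forbids: the integral of `y` is a Weierstrass zeta function, not an elliptic one. If the leading
part is forced, it is compared with an explicit particular solution having a pole along `E = 0`. -/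

noncomputable section
namespace PainleveFoliation

/-! ### Derivatives along the autonomous flow, in the normal form `A + y' B`. -/

open Polynomial in
/-- The polynomials in `c`, `y` and `x`, with `x` the outermost variable. -/
abbrev EnergyPoly : Type := ℂ[X][X][X]

/-- The energy `y' ^ 2 - 4 y ^ 3` of the autonomous equation `y'' = 6 y ^ 2`. -/
def energy : Poly := MvPolynomial.X 2 ^ 2 - 4 * MvPolynomial.X 1 ^ 3

/-- The vector field `e ∂/∂x + y' ∂/∂y + 6 y ^ 2 ∂/∂y'`, as a derivation of polynomials. -/
def flow (e : ℂ) : Derivation ℂ Poly Poly :=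
  MvPolynomial.mkDerivation ℂ ![MvPolynomial.C e, MvPolynomial.X 2, 6 * MvPolynomial.X 1 ^ 2]

@[simp] theorem flow_X_zero (e : ℂ) : flow e (MvPolynomial.X 0) = MvPolynomial.C e := by
  simp [flow, MvPolynomial.mkDerivation_X]

@[simp] theorem flow_X_one (e : ℂ) : flow e (MvPolynomial.X 1) = MvPolynomial.X 2 := by
  simp [flow, MvPolynomial.mkDerivation_X]

@[simp] theorem flow_X_two (e : ℂ) :
    flow e (MvPolynomial.X 2) = 6 * MvPolynomial.X 1 ^ 2 := by
  simp [flow, MvPolynomial.mkDerivation_X]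

/-- The square of `y'` as a polynomial in `c` and `y`. -/
def cubic : EnergyPoly := Polynomial.C (4 * Polynomial.X ^ 3 + Polynomial.C Polynomial.X)

/-- The polynomials `A + y' B` with `A`, `B` polynomials in `c, y, x`. -/
abbrev EnergyAlg : Type := QuadraticAlgebra EnergyPoly cubic 0

/-- Rewriting of polynomials in `x, y, y'` in the form `A + y' B` with `A`, `B` polynomials in
`c, y, x`. -/
def toEnergy : Poly →ₐ[ℂ] EnergyAlg :=
  MvPolynomial.aeval ![⟨Polynomial.X, 0⟩, ⟨Polynomial.C Polynomial.X, 0⟩, ⟨0, 1⟩]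

@[simp] theorem toEnergy_X_zero : toEnergy (MvPolynomial.X 0) = ⟨Polynomial.X, 0⟩ := by
  simp [toEnergy]

@[simp] theorem toEnergy_X_one :
    toEnergy (MvPolynomial.X 1) = ⟨Polynomial.C Polynomial.X, 0⟩ := by
  simp [toEnergy]

@[simp] theorem toEnergy_X_two : toEnergy (MvPolynomial.X 2) = ⟨0, 1⟩ := by
  simp [toEnergy]

theorem toEnergy_C (a : ℂ) : toEnergy (MvPolynomial.C a) =
    ⟨Polynomial.C (Polynomial.C (Polynomial.C a)), 0⟩ := by
  simp only [toEnergy, MvPolynomial.aeval_C]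
  rfl

/-- The substitution of the energy for `c`. -/
def ofEnergy : EnergyPoly →+* Poly :=
  Polynomial.eval₂RingHom (Polynomial.eval₂RingHom
    (Polynomial.eval₂RingHom MvPolynomial.C energy) (MvPolynomial.X 1)) (MvPolynomial.X 0)

/-- With `c` the energy, `y'² = 4y³ + c`, so `y'` is quadratic over `ℂ[c, y, x]`. Together with
`toEnergy_ofEnergy` this lets identities be checked on the two coordinates `A` and `B`. -/
theorem ofEnergy_toEnergy (f : Poly) :
    ofEnergy (toEnergy f).re + MvPolynomial.X 2 * ofEnergy (toEnergy f).im = f := by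
  have hX : ofEnergy Polynomial.X = MvPolynomial.X 0 := by simp [ofEnergy]
  have hY : ofEnergy (Polynomial.C Polynomial.X) = MvPolynomial.X 1 := by simp [ofEnergy]
  have hc : ofEnergy cubic = MvPolynomial.X 2 ^ 2 := by
    simp [ofEnergy, cubic, energy, -map_pow]
  induction f using MvPolynomial.induction_on with
  | C a => simp [toEnergy_C, ofEnergy, -MvPolynomial.algHom_C]
  | add p q hp hq =>
    simp only [map_add, QuadraticAlgebra.re_add, QuadraticAlgebra.im_add]
    linear_combination hp + hq
  | mul_X p i hp =>
    fin_cases i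
    · simp [hX]; linear_combination MvPolynomial.X 0 * hp
    · simp [hY]; linear_combination MvPolynomial.X 1 * hp
    · simp [hc]; linear_combination MvPolynomial.X 2 * hp

/-- The derivative with respect to `y`. -/
def derivY (A : EnergyPoly) : EnergyPoly := A.sum fun n a => Polynomial.monomial n a.derivative

theorem coeff_derivY (A : EnergyPoly) (n : ℕ) : (derivY A).coeff n = (A.coeff n).derivative := by
  rw [derivY, Polynomial.sum_def, Polynomial.finsetSum_coeff]
  simp only [Polynomial.coeff_monomial, Finset.sum_ite_eq', Polynomial.mem_support_iff]
  split_ifs with h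
  · rfl
  · rw [not_not.1 h, map_zero]

theorem derivY_add (A B : EnergyPoly) : derivY (A + B) = derivY A + derivY B := by
  ext1 n; simp [coeff_derivY]

theorem derivY_mul (A B : EnergyPoly) : derivY (A * B) = derivY A * B + A * derivY B := by
  ext1 n
  simp only [coeff_derivY, Polynomial.coeff_add, Polynomial.coeff_mul, map_sum,
    Polynomial.derivative_mul, Finset.sum_add_distrib]

theorem derivY_C (a : Polynomial (Polynomial ℂ)) :
    derivY (Polynomial.C a) = Polynomial.C a.derivative := by
  ext1 n
  rw [coeff_derivY, Polynomial.coeff_C, Polynomial.coeff_C]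
  split_ifs <;> simp

theorem derivY_X : derivY Polynomial.X = 0 := by
  ext1 n
  rw [coeff_derivY, Polynomial.coeff_X]
  split_ifs <;> simp

theorem derivative_cubic : Polynomial.derivative cubic = 0 := Polynomial.derivative_C

theorem derivY_cubic : derivY cubic = 12 * Polynomial.C Polynomial.X ^ 2 := by
  have h12 : (12 : EnergyPoly) = Polynomial.C 12 := (map_ofNat Polynomial.C 12).symm
  have h3 : Polynomial.C (3 : Polynomial ℂ) = 3 := map_ofNat Polynomial.C 3
  rw [cubic, derivY_C, h12, ← Polynomial.C_pow, ← Polynomial.C_mul]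
  congr 1
  simp only [Polynomial.derivative_add, Polynomial.derivative_mul, Polynomial.derivative_C,
    Polynomial.derivative_X_pow, Polynomial.derivative_ofNat]
  push_cast
  simp only [h3]
  ring

/-- The energy is constant along the flow, so only `x`, `y` and the factor `y'` are differentiated,
with `y' · y'` replaced by `cubic`. -/
theorem toEnergy_flow (e : ℂ) (f : Poly) : toEnergy (flow e f) =
    ⟨Polynomial.C (Polynomial.C (Polynomial.C e)) * (toEnergy f).re.derivative +
      6 * Polynomial.C Polynomial.X ^ 2 * (toEnergy f).im + cubic * derivY (toEnergy f).im,
      Polynomial.C (Polynomial.C (Polynomial.C e)) * (toEnergy f).im.derivative +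
      derivY (toEnergy f).re⟩ := by
  have h6 : toEnergy 6 = ⟨6, 0⟩ := map_ofNat toEnergy 6
  induction f using MvPolynomial.induction_on with
  | C a =>
    simp only [MvPolynomial.derivation_C, map_zero, toEnergy_C, derivY_C]
    ext1 <;> simp [derivY]
  | add p q hp hq =>
    simp only [map_add, hp, hq]
    ext1 <;> simp [derivY_add] <;> ring
  | mul_X p i hp =>
    simp only [Derivation.leibniz, smul_eq_mul, map_add, map_mul, hp]
    fin_cases i
    · ext1 <;> simp [derivY_mul, derivY_X, toEnergy_C, -MvPolynomial.algHom_C] <;> ring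
    · ext1 <;> simp [derivY_mul, derivY_C] <;> ring
    · ext1 <;> simp [derivY_mul, derivY_cubic, derivative_cubic, h6, pow_two] <;> ring

theorem toEnergy_energy : toEnergy energy = ⟨Polynomial.C (Polynomial.C Polynomial.X), 0⟩ := by
  have h4 : toEnergy 4 = ⟨4, 0⟩ := map_ofNat toEnergy 4
  have h4' : Polynomial.C (4 : Polynomial (Polynomial ℂ)) = 4 := map_ofNat Polynomial.C 4
  have h : energy = MvPolynomial.X 2 * MvPolynomial.X 2 -
      4 * (MvPolynomial.X 1 * MvPolynomial.X 1 * MvPolynomial.X 1) := by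
    rw [energy]; ring
  rw [h, map_sub, map_mul, map_mul, map_mul, map_mul, toEnergy_X_two, toEnergy_X_one, h4]
  have h' : cubic = 4 * (Polynomial.C Polynomial.X * Polynomial.C Polynomial.X *
      Polynomial.C Polynomial.X) + Polynomial.C (Polynomial.C Polynomial.X) := by
    simp [h4', pow_succ, cubic]
  ext1
  · simp only [QuadraticAlgebra.re_sub, QuadraticAlgebra.re_mul, QuadraticAlgebra.im_mul]
    rw [h']
    ring
  · simp only [QuadraticAlgebra.im_sub, QuadraticAlgebra.re_mul, QuadraticAlgebra.im_mul]
    ring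

theorem toEnergy_ofEnergy (E : EnergyPoly) : toEnergy (ofEnergy E) = ⟨E, 0⟩ := by
  have hadd {E F : EnergyPoly} (hE : toEnergy (ofEnergy E) = ⟨E, 0⟩)
      (hF : toEnergy (ofEnergy F) = ⟨F, 0⟩) : toEnergy (ofEnergy (E + F)) = ⟨E + F, 0⟩ := by
    rw [map_add, map_add, hE, hF]
    ext1 <;> simp
  have hmul {E F : EnergyPoly} (hE : toEnergy (ofEnergy E) = ⟨E, 0⟩)
      (hF : toEnergy (ofEnergy F) = ⟨F, 0⟩) : toEnergy (ofEnergy (E * F)) = ⟨E * F, 0⟩ := by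
    rw [map_mul, map_mul, hE, hF]
    ext1 <;> simp
  have hc (u : Polynomial ℂ) : toEnergy (ofEnergy (Polynomial.C (Polynomial.C u))) =
      ⟨Polynomial.C (Polynomial.C u), 0⟩ := by
    induction u using Polynomial.induction_on with
    | C a => simp [ofEnergy, toEnergy_C, -MvPolynomial.algHom_C]
    | add p q hp hq => simpa only [Polynomial.C_add] using hadd hp hq
    | monomial n a h =>
      have hX : toEnergy (ofEnergy (Polynomial.C (Polynomial.C Polynomial.X))) =
          ⟨Polynomial.C (Polynomial.C Polynomial.X), 0⟩ := by
        simp [ofEnergy, toEnergy_energy]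
      rw [pow_succ, ← mul_assoc, Polynomial.C_mul (b := Polynomial.X),
        Polynomial.C_mul (b := Polynomial.C Polynomial.X)]
      exact hmul h hX
  have hy (u : Polynomial (Polynomial ℂ)) :
      toEnergy (ofEnergy (Polynomial.C u)) = ⟨Polynomial.C u, 0⟩ := by
    induction u using Polynomial.induction_on with
    | C a => exact hc a
    | add p q hp hq => simpa only [Polynomial.C_add] using hadd hp hq
    | monomial n a h =>
      have hX : toEnergy (ofEnergy (Polynomial.C Polynomial.X)) =
          ⟨Polynomial.C Polynomial.X, 0⟩ := by
        simp [ofEnergy]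
      rw [pow_succ, ← mul_assoc, Polynomial.C_mul (b := Polynomial.X)]
      exact hmul h hX
  induction E using Polynomial.induction_on with
  | C a => exact hy a
  | add p q hp hq => exact hadd hp hq
  | monomial n a h =>
    have hX : toEnergy (ofEnergy Polynomial.X) = ⟨Polynomial.X, 0⟩ := by simp [ofEnergy]
    rw [pow_succ, ← mul_assoc]
    exact hmul h hX

theorem aeval_energy (u : Polynomial ℂ) :
    Polynomial.aeval energy u = ofEnergy (Polynomial.C (Polynomial.C u)) := by
  simp [ofEnergy, Polynomial.aeval_def]

/-- In degree `deg B + 2` the coefficient is `6 + 4 deg B` times the leading coefficient of `B`, so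
a nonzero `B` would give degree at least two. -/
theorem eq_zero_of_natDegree_le_one {B : Polynomial (Polynomial ℂ)}
    (h : (6 * Polynomial.X ^ 2 * B + (4 * Polynomial.X ^ 3 + Polynomial.C Polynomial.X) *
      Polynomial.derivative B).natDegree ≤ 1) : B = 0 := by
  by_contra hB
  have h0 := Polynomial.coeff_eq_zero_of_natDegree_lt
    (show _ < B.natDegree + 2 from lt_of_le_of_lt h (by omega))
  have h1 : (Polynomial.X ^ 3 * Polynomial.derivative B).coeff (B.natDegree + 2) =
      B.natDegree * B.coeff B.natDegree := by
    rw [Polynomial.coeff_X_pow_mul']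
    rcases Nat.eq_zero_or_pos B.natDegree with h | h
    · simp [h]
    · obtain ⟨m, hm⟩ := Nat.exists_eq_add_of_lt h
      rw [zero_add] at hm
      rw [if_pos (by omega), Polynomial.coeff_derivative, hm, show m + 1 + 2 - 3 = m by omega]
      push_cast
      ring
  have h2 : B.coeff (B.natDegree + 2 + 1) = 0 :=
    Polynomial.coeff_eq_zero_of_natDegree_lt (by omega)
  rw [add_mul, Polynomial.coeff_add, Polynomial.coeff_add, Polynomial.coeff_C_mul,
    mul_assoc, mul_assoc, Polynomial.coeff_ofNat_mul, Polynomial.coeff_ofNat_mul, h1,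
    Polynomial.coeff_X_pow_mul, Polynomial.coeff_derivative, h2] at h0
  have h3 : ((6 + 4 * B.natDegree : ℕ) : Polynomial ℂ) * B.coeff B.natDegree = 0 := by
    push_cast
    linear_combination h0
  rcases mul_eq_zero.1 h3 with h4 | h4
  · exact absurd (Nat.cast_eq_zero.1 h4) (by omega)
  · exact hB (Polynomial.leadingCoeff_eq_zero.1 h4)

theorem coeff_flow_re (e : ℂ) (g : Poly) (n : ℕ) :
    (toEnergy (flow e g)).re.coeff n =
      Polynomial.C (Polynomial.C e) *
        ((toEnergy g).re.coeff (n + 1) * ((n : Polynomial (Polynomial ℂ)) + 1)) +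
      (6 * Polynomial.X ^ 2 * (toEnergy g).im.coeff n +
      (4 * Polynomial.X ^ 3 + Polynomial.C Polynomial.X) *
        Polynomial.derivative ((toEnergy g).im.coeff n)) := by
  have h6 : (6 : EnergyPoly) = Polynomial.C 6 := (map_ofNat Polynomial.C 6).symm
  rw [toEnergy_flow]
  simp only [Polynomial.coeff_add, Polynomial.coeff_C_mul, Polynomial.coeff_derivative, cubic,
    coeff_derivY, h6, ← Polynomial.C_pow, ← Polynomial.C_mul]
  ring

theorem coeff_flow_im (e : ℂ) (g : Poly) (n : ℕ) :
    (toEnergy (flow e g)).im.coeff n =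
      Polynomial.C (Polynomial.C e) *
        ((toEnergy g).im.coeff (n + 1) * ((n : Polynomial (Polynomial ℂ)) + 1)) +
      Polynomial.derivative ((toEnergy g).re.coeff n) := by
  rw [toEnergy_flow]
  simp only [Polynomial.coeff_add, Polynomial.coeff_C_mul, Polynomial.coeff_derivative,
    coeff_derivY]

/-- A function of `x` and the energy is a derivative along the frozen flow only if it vanishes. -/
theorem flow_zero_eq_energy {g : Poly} {h : Polynomial (Polynomial ℂ)}
    (hg : flow 0 g = ofEnergy (h.map Polynomial.C)) :
    h = 0 ∧ ∃ k : Polynomial (Polynomial ℂ), g = ofEnergy (k.map Polynomial.C) := by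
  have hre (n : ℕ) := coeff_flow_re 0 g n
  have him (n : ℕ) := coeff_flow_im 0 g n
  simp only [hg, toEnergy_ofEnergy, Polynomial.C_0, zero_mul, zero_add, Polynomial.coeff_map,
    Polynomial.coeff_zero] at hre him
  -- The prescribed derivative does not involve `y`, so its degree in `y` is zero.
  have hB (n : ℕ) : (toEnergy g).im.coeff n = 0 :=
    eq_zero_of_natDegree_le_one (by rw [← hre n]; simp)
  constructor
  · ext1 n
    simpa [hB] using hre n
  · refine ⟨(toEnergy g).re.map Polynomial.constantCoeff, ?_⟩
    have hB' : (toEnergy g).im = 0 := by ext1 n; simpa using hB n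
    conv_lhs => rw [← ofEnergy_toEnergy g, hB', map_zero, mul_zero, add_zero]
    congr 1
    ext1 n
    have := Polynomial.derivative_eq_zero.1 (him n).symm
    simpa using Polynomial.eq_C_of_natDegree_eq_zero this

/-- A polynomial in the energy times `y` is a derivative along the flow only if it vanishes. -/
theorem flow_eq_energy_mul_y {g : Poly} {u : Polynomial ℂ}
    (hg : flow 1 g = Polynomial.aeval energy u * MvPolynomial.X 1) :
    u = 0 ∧ ∃ v : Polynomial ℂ, g = Polynomial.aeval energy v := by
  have hre (n : ℕ) := coeff_flow_re 1 g n
  have him (n : ℕ) := coeff_flow_im 1 g n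
  have h1 : toEnergy (flow 1 g) = ⟨Polynomial.C (Polynomial.C u * Polynomial.X), 0⟩ := by
    rw [hg, map_mul, aeval_energy, toEnergy_ofEnergy]
    ext1 <;> simp
  simp only [h1, Polynomial.C_1, one_mul, Polynomial.coeff_zero, Polynomial.coeff_C] at hre him
  -- Descent on the power of `x`: if `B_{n+2} = 0` then `A_{n+1}` is constant in `y`, so the terms
  -- in `B_n` add up to degree at most one in `y` and `B_n = 0`. Comparing the coefficients of `1`
  -- and `y` then kills `A_{n+1}` and, for `n = 0`, `u`.
  have step (n : ℕ) (hB : (toEnergy g).im.coeff (n + 2) = 0) :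
      (toEnergy g).im.coeff n = 0 ∧ (toEnergy g).re.coeff (n + 1) = 0 ∧ (n = 0 → u = 0) := by
    have h2 := him (n + 1)
    rw [show n + 1 + 1 = n + 2 from rfl, hB, zero_mul, zero_add] at h2
    obtain ⟨a, ha⟩ : ∃ a, (toEnergy g).re.coeff (n + 1) = Polynomial.C a :=
      ⟨_, Polynomial.eq_C_of_natDegree_eq_zero
        (Polynomial.derivative_eq_zero.1 h2.symm)⟩
    have h3 := hre n
    have h4 : Polynomial.C a * ((n : Polynomial (Polynomial ℂ)) + 1) =
        Polynomial.C (a * ((n : Polynomial ℂ) + 1)) := by simp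
    rw [ha, h4] at h3
    have h5 : (toEnergy g).im.coeff n = 0 := by
      refine eq_zero_of_natDegree_le_one ?_
      rw [← sub_eq_iff_eq_add'.2 h3]
      refine Polynomial.natDegree_sub_C.trans_le ?_
      split_ifs
      · exact (Polynomial.natDegree_C_mul_le _ _).trans Polynomial.natDegree_X_le
      · simp
    rw [h5, mul_zero, map_zero, mul_zero, add_zero, add_zero] at h3
    have h6 := congrArg (fun p => Polynomial.coeff p 0) h3
    have h7 := congrArg (fun p => Polynomial.coeff p 1) h3
    have hn : (n : Polynomial ℂ) + 1 ≠ 0 := Nat.cast_add_one_ne_zero n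
    refine ⟨h5, ?_, ?_⟩
    · have : a * ((n : Polynomial ℂ) + 1) = 0 := by
        rw [← Polynomial.coeff_C_zero (a := a * _)]
        refine h6.symm.trans ?_
        split_ifs <;> simp
      rw [ha, (mul_eq_zero.1 this).resolve_right hn, map_zero]
    · rintro rfl
      simpa [Polynomial.coeff_C] using h7
  have all (k n : ℕ) (hk : (toEnergy g).im.natDegree < n + k) :
      (toEnergy g).im.coeff n = 0 := by
    induction k generalizing n with
    | zero => exact Polynomial.coeff_eq_zero_of_natDegree_lt hk
    | succ k ih => exact (step n (ih _ (by omega))).1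
  have hB (n : ℕ) : (toEnergy g).im.coeff n = 0 :=
    all ((toEnergy g).im.natDegree + 1) n (by omega)
  refine ⟨(step 0 (hB 2)).2.2 rfl, ((toEnergy g).re.coeff 0).coeff 0, ?_⟩
  have hB' : (toEnergy g).im = 0 := by ext1 n; simpa using hB n
  have hA : (toEnergy g).re = Polynomial.C ((toEnergy g).re.coeff 0) := by
    ext1 n
    cases n with
    | zero => simp
    | succ n => rw [(step n (hB _)).2.1, Polynomial.coeff_C_succ]
  have h8 := him 0
  rw [hB, zero_mul, zero_add] at h8
  have h9 := Polynomial.eq_C_of_natDegree_eq_zero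
    (Polynomial.derivative_eq_zero.1 h8.symm)
  rw [aeval_energy, ← h9, ← hA]
  conv_lhs => rw [← ofEnergy_toEnergy g, hB', map_zero, mul_zero, add_zero]

end PainleveFoliation
end

noncomputable section
namespace PainleveFoliation

open MvPolynomial

/-! ### Integer weights and leading terms. -/

theorem component_map {ω : Fin 3 → ℤ} {d : ℤ} (T : Poly →ₗ[ℂ] Poly)
    (hT : ∀ m f, IsWeightedHomogeneous ω f m → IsWeightedHomogeneous ω (T f) (m + d))
    (n : ℤ) (f : Poly) :
    weightedHomogeneousComponent ω (n + d) (T f) = T (weightedHomogeneousComponent ω n f) := by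
  suffices h : weightedHomogeneousComponent ω (n + d) ∘ₗ T =
      T ∘ₗ weightedHomogeneousComponent ω n from LinearMap.congr_fun h f
  refine MvPolynomial.linearMap_ext fun s => LinearMap.ext fun a => ?_
  have hs : IsWeightedHomogeneous ω (monomial s a) (Finsupp.weight ω s) :=
    isWeightedHomogeneous_monomial _ _ _ rfl
  simp only [LinearMap.comp_apply]
  by_cases h : Finsupp.weight ω s = n
  · rw [← h, hs.weightedHomogeneousComponent_same, (hT _ _ hs).weightedHomogeneousComponent_same]
  · rw [hs.weightedHomogeneousComponent_ne _ (by omega),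
      (hT _ _ hs).weightedHomogeneousComponent_ne _ (by omega), map_zero]

theorem isWeightedHomogeneous_derivation {ω : Fin 3 → ℤ} {d : ℤ} (D : Derivation ℂ Poly Poly)
    (hD : ∀ i, IsWeightedHomogeneous ω (D (X i)) (ω i + d)) (m : ℤ) (f : Poly)
    (hf : IsWeightedHomogeneous ω f m) : IsWeightedHomogeneous ω (D f) (m + d) := by
  have hD' : D = mkDerivation ℂ fun i => D (X i) := derivation_ext fun i => by
    rw [mkDerivation_X]
  rw [f.as_sum, map_sum]
  refine IsWeightedHomogeneous.sum _ _ _ fun s hs => ?_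
  have hs' : Finsupp.weight ω s = m := hf (mem_support_iff.1 hs)
  rw [hD', mkDerivation_monomial, smul_eq_C_mul]
  refine IsWeightedHomogeneous.C_mul (IsWeightedHomogeneous.sum _ _ _ fun i hi => ?_) _
  have h1 : s - Finsupp.single i 1 + Finsupp.single i 1 = s :=
    tsub_add_cancel_of_le (by
      rw [Finsupp.single_le_iff]
      exact Nat.one_le_iff_ne_zero.2 (Finsupp.mem_support_iff.1 hi))
  have h2 : Finsupp.weight ω (s - Finsupp.single i 1) + ω i = m := by
    rw [← hs', ← h1, map_add, Finsupp.weight_single]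
    simp
  rw [← h2, add_assoc]
  exact (isWeightedHomogeneous_monomial _ _ _ rfl).mul (hD i)

/-- The polynomials all of whose monomials have weight at most `n`. -/
def weightLE (ω : Fin 3 → ℤ) (n : ℤ) : Submodule ℂ Poly where
  carrier := {f | ∀ s, coeff s f ≠ 0 → Finsupp.weight ω s ≤ n}
  zero_mem' := by simp
  add_mem' {f g} hf hg s hs := by
    by_cases h : coeff s f = 0
    · exact hg s (by simpa [h] using hs)
    · exact hf s h
  smul_mem' a f hf s hs := hf s fun h => hs (by simp [h])

theorem mem_weightLE_of_hom {ω : Fin 3 → ℤ} {n : ℤ} {f : Poly}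
    (hf : IsWeightedHomogeneous ω f n) : f ∈ weightLE ω n := fun _ hs => (hf hs).le

theorem weightLE_mono {ω : Fin 3 → ℤ} {m n : ℤ} (h : m ≤ n) : weightLE ω m ≤ weightLE ω n :=
  fun _ hf s hs => (hf s hs).trans h

theorem mul_mem_weightLE {ω : Fin 3 → ℤ} {m n : ℤ} {f g : Poly} (hf : f ∈ weightLE ω m)
    (hg : g ∈ weightLE ω n) : f * g ∈ weightLE ω (m + n) := by
  intro s hs
  classical
  obtain ⟨a, ha, b, hb, rfl⟩ := Finset.mem_add.1 (support_mul f g (mem_support_iff.2 hs))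
  rw [map_add]
  exact add_le_add (hf a (mem_support_iff.1 ha)) (hg b (mem_support_iff.1 hb))

theorem map_mem_weightLE {ω : Fin 3 → ℤ} {d : ℤ} (T : Poly →ₗ[ℂ] Poly)
    (hT : ∀ m f, IsWeightedHomogeneous ω f m → IsWeightedHomogeneous ω (T f) (m + d))
    {n : ℤ} {f : Poly} (hf : f ∈ weightLE ω n) : T f ∈ weightLE ω (n + d) := by
  rw [f.as_sum, map_sum]
  refine Submodule.sum_mem _ fun s hs => ?_
  have h := hf s (mem_support_iff.1 hs)
  exact weightLE_mono (by omega)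
    (mem_weightLE_of_hom (hT _ _ (isWeightedHomogeneous_monomial ω s _ rfl)))

theorem component_eq_zero {ω : Fin 3 → ℤ} {m n : ℤ} {f : Poly} (hf : f ∈ weightLE ω m)
    (h : m < n) : weightedHomogeneousComponent ω n f = 0 :=
  weightedHomogeneousComponent_eq_zero' n f fun s hs => by
    have := hf s (mem_support_iff.1 hs)
    omega

theorem exists_top_weight (ω : Fin 3 → ℤ) {f : Poly} (hf : f ≠ 0) :
    ∃ n, f ∈ weightLE ω n ∧ weightedHomogeneousComponent ω n f ≠ 0 := by
  obtain ⟨s, hs, hmax⟩ := f.support.exists_max_image (Finsupp.weight ω) (support_nonempty.2 hf)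
  refine ⟨Finsupp.weight ω s, fun t ht => hmax t (mem_support_iff.2 ht), fun h => ?_⟩
  have := congrArg (coeff s) h
  rw [coeff_weightedHomogeneousComponent, if_pos rfl] at this
  exact mem_support_iff.1 hs this

/-- `a` is the part of weight `n` of `f`, and `f` has no part of higher weight. -/
structure IsLead (ω : Fin 3 → ℤ) (f : Poly) (n : ℤ) (a : Poly) : Prop where
  hom : IsWeightedHomogeneous ω a n
  low : f - a ∈ weightLE ω (n - 1)

namespace IsLead

variable {ω : Fin 3 → ℤ} {f g a b : Poly} {m n : ℤ}

theorem of_hom (h : IsWeightedHomogeneous ω f n) : IsLead ω f n f :=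
  ⟨h, by rw [sub_self]; exact zero_mem _⟩

theorem of_component (h : f ∈ weightLE ω n) :
    IsLead ω f n (weightedHomogeneousComponent ω n f) := by
  refine ⟨weightedHomogeneousComponent_isWeightedHomogeneous n f, fun s hs => ?_⟩
  rw [coeff_sub, coeff_weightedHomogeneousComponent] at hs
  split_ifs at hs with h1
  · simp at hs
  · have := h s (by simpa using hs)
    omega

/-- A zero leading term is allowed; this is how terms of lower weight are discarded. -/
theorem of_lt (h : f ∈ weightLE ω m) (hmn : m < n) : IsLead ω f n 0 :=
  ⟨isWeightedHomogeneous_zero ℂ ω n, by rw [sub_zero]; exact weightLE_mono (by omega) h⟩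

theorem mem (h : IsLead ω f n a) : f ∈ weightLE ω n := by
  rw [← sub_add_cancel f a]
  exact add_mem (weightLE_mono (by omega) h.low) (mem_weightLE_of_hom h.hom)

theorem component (h : IsLead ω f n a) : weightedHomogeneousComponent ω n f = a := by
  rw [← sub_add_cancel f a, map_add, component_eq_zero h.low (by omega), zero_add,
    h.hom.weightedHomogeneousComponent_same]

theorem add (hf : IsLead ω f n a) (hg : IsLead ω g n b) : IsLead ω (f + g) n (a + b) :=
  ⟨hf.hom.add hg.hom, by rw [add_sub_add_comm]; exact add_mem hf.low hg.low⟩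

theorem neg (hf : IsLead ω f n a) : IsLead ω (-f) n (-a) :=
  ⟨hf.hom.neg, by rw [← neg_sub']; exact neg_mem hf.low⟩

theorem sub (hf : IsLead ω f n a) (hg : IsLead ω g n b) : IsLead ω (f - g) n (a - b) := by
  rw [sub_eq_add_neg, sub_eq_add_neg]
  exact hf.add hg.neg

theorem mul (hf : IsLead ω f m a) (hg : IsLead ω g n b) : IsLead ω (f * g) (m + n) (a * b) := by
  refine ⟨hf.hom.mul hg.hom, ?_⟩
  have h : f * g - a * b = (f - a) * g + a * (g - b) := by ring
  rw [h]
  exact add_mem (weightLE_mono (by omega) (mul_mem_weightLE hf.low hg.mem))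
    (weightLE_mono (by omega) (mul_mem_weightLE (mem_weightLE_of_hom hf.hom) hg.low))

theorem map {d : ℤ} (T : Poly →ₗ[ℂ] Poly)
    (hT : ∀ m f, IsWeightedHomogeneous ω f m → IsWeightedHomogeneous ω (T f) (m + d))
    (hf : IsLead ω f n a) : IsLead ω (T f) (n + d) (T a) :=
  ⟨hT _ _ hf.hom, by
    rw [← map_sub]; exact weightLE_mono (by omega) (map_mem_weightLE T hT hf.low)⟩

theorem const_mul (r : ℂ) (hf : IsLead ω f n a) : IsLead ω (C r * f) n (C r * a) := by
  have := (of_hom (isWeightedHomogeneous_C ω r)).mul hf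
  rwa [zero_add] at this

end IsLead

/-! ### The Painlevé field as a perturbation of homogeneous fields. -/

/-- The vector field `x ∂/∂y'`, as a derivation of polynomials. -/
def pert : Derivation ℂ Poly Poly := mkDerivation ℂ ![0, 0, X 0]

@[simp] theorem pert_X_zero : pert (X 0) = 0 := by simp [pert, mkDerivation_X]

@[simp] theorem pert_X_one : pert (X 1) = 0 := by simp [pert, mkDerivation_X]

@[simp] theorem pert_X_two : pert (X 2) = X 0 := by simp [pert, mkDerivation_X]

/-- The vector field of the first Painlevé equation, as a derivation of polynomials. -/
def painleveDer : Derivation ℂ Poly Poly := flow 1 + pert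

@[simp] theorem painleveDer_X_zero : painleveDer (X 0) = 1 := by simp [painleveDer]

@[simp] theorem painleveDer_X_one : painleveDer (X 1) = X 2 := by simp [painleveDer]

@[simp] theorem painleveDer_X_two : painleveDer (X 2) = 6 * X 1 ^ 2 + X 0 := by
  simp [painleveDer]

theorem painleveDer_eq_frozen : painleveDer = flow 0 + pderiv 0 + pert := by
  refine derivation_ext fun i => ?_
  fin_cases i <;> simp [pderiv_X]

/-- The weights of `x, y, y'` for which the flow of `y'' = 6 y ^ 2` is homogeneous. -/
def scaling : Fin 3 → ℤ := ![-1, 2, 3]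

/-- The weights of `x, y, y'` for which the frozen flow of `y'' = 6 y ^ 2` is homogeneous. -/
def frozenScaling : Fin 3 → ℤ := ![0, 2, 3]

theorem derivation_ofNat {A : Type*} [CommSemiring A] [Algebra ℂ A] (D : Derivation ℂ A A)
    (k : ℕ) [k.AtLeastTwo] : D ofNat(k) = 0 :=
  D.map_natCast k

theorem hom_X_zero : IsWeightedHomogeneous scaling (X 0 : Poly) (-1) :=
  isWeightedHomogeneous_X ℂ scaling 0

theorem hom_X_one : IsWeightedHomogeneous scaling (X 1 : Poly) 2 :=
  isWeightedHomogeneous_X ℂ scaling 1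

theorem hom_X_two : IsWeightedHomogeneous scaling (X 2 : Poly) 3 :=
  isWeightedHomogeneous_X ℂ scaling 2

theorem hom_ofNat_mul {ω : Fin 3 → ℤ} {f : Poly} {n : ℤ} (k : ℕ) [k.AtLeastTwo]
    (hf : IsWeightedHomogeneous ω f n) :
    IsWeightedHomogeneous ω ((OfNat.ofNat k : Poly) * f) n := by
  have h : (OfNat.ofNat k : Poly) = C (OfNat.ofNat k) := (map_ofNat C k).symm
  rw [h]
  exact hf.C_mul _

theorem hom_flow (m : ℤ) (f : Poly) (hf : IsWeightedHomogeneous scaling f m) :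
    IsWeightedHomogeneous scaling (flow 1 f) (m + 1) := by
  refine isWeightedHomogeneous_derivation _ (fun i => ?_) m f hf
  fin_cases i
  · simpa [scaling] using isWeightedHomogeneous_one ℂ scaling
  · simpa [scaling] using hom_X_two
  · simpa [scaling] using hom_ofNat_mul 6 (hom_X_one.pow 2)

theorem hom_pert (m : ℤ) (f : Poly) (hf : IsWeightedHomogeneous scaling f m) :
    IsWeightedHomogeneous scaling (pert f) (m + -4) := by
  refine isWeightedHomogeneous_derivation _ (fun i => ?_) m f hf
  fin_cases i
  · simpa using isWeightedHomogeneous_zero ℂ scaling _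
  · simpa using isWeightedHomogeneous_zero ℂ scaling _
  · simpa [scaling] using hom_X_zero

theorem hom_frozen_flow (m : ℤ) (f : Poly) (hf : IsWeightedHomogeneous frozenScaling f m) :
    IsWeightedHomogeneous frozenScaling (flow 0 f) (m + 1) := by
  refine isWeightedHomogeneous_derivation _ (fun i => ?_) m f hf
  fin_cases i
  · simpa using isWeightedHomogeneous_zero ℂ frozenScaling _
  · simpa [frozenScaling] using isWeightedHomogeneous_X ℂ frozenScaling 2
  · simpa [frozenScaling] using
      hom_ofNat_mul 6 ((isWeightedHomogeneous_X ℂ frozenScaling 1).pow 2)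

theorem hom_frozen_pert (m : ℤ) (f : Poly) (hf : IsWeightedHomogeneous frozenScaling f m) :
    IsWeightedHomogeneous frozenScaling (pert f) (m + -3) := by
  refine isWeightedHomogeneous_derivation _ (fun i => ?_) m f hf
  fin_cases i
  · simpa using isWeightedHomogeneous_zero ℂ frozenScaling _
  · simpa using isWeightedHomogeneous_zero ℂ frozenScaling _
  · simpa [frozenScaling] using isWeightedHomogeneous_X ℂ frozenScaling 0

theorem hom_frozen_pderiv (m : ℤ) (f : Poly) (hf : IsWeightedHomogeneous frozenScaling f m) :
    IsWeightedHomogeneous frozenScaling (pderiv 0 f) (m + 0) := by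
  refine isWeightedHomogeneous_derivation _ (fun i => ?_) m f hf
  fin_cases i
  · simpa [frozenScaling] using isWeightedHomogeneous_one ℂ frozenScaling
  · simpa [pderiv_X] using isWeightedHomogeneous_zero ℂ frozenScaling _
  · simpa [pderiv_X] using isWeightedHomogeneous_zero ℂ frozenScaling _

theorem hom_energy : IsWeightedHomogeneous scaling energy 6 := by
  simpa [energy] using (hom_X_two.pow 2).sub (hom_ofNat_mul 4 (hom_X_one.pow 3))

theorem flow_energy : flow 1 energy = 0 := by
  simp [energy, Derivation.leibniz, Derivation.leibniz_pow, derivation_ofNat]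
  ring

theorem pert_energy : pert energy = 2 * X 0 * X 2 := by
  simp [energy, Derivation.leibniz, Derivation.leibniz_pow, derivation_ofNat]
  ring

theorem flow_energy_pow (k : ℕ) : flow 1 (energy ^ k) = 0 := by
  rw [Derivation.leibniz_pow, flow_energy, smul_zero, smul_zero]

theorem energy_ne_zero : energy ≠ 0 := by
  intro h
  have := congrArg (eval ![0, 0, 1]) h
  simp [energy] at this

theorem component_painleveDer (n : ℤ) (f : Poly) :
    weightedHomogeneousComponent scaling n (painleveDer f) =
      flow 1 (weightedHomogeneousComponent scaling (n - 1) f) +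
      pert (weightedHomogeneousComponent scaling (n + 4) f) := by
  have h1 := component_map (flow 1).toLinearMap hom_flow (n - 1) f
  have h2 := component_map pert.toLinearMap hom_pert (n + 4) f
  rw [sub_add_cancel] at h1
  rw [add_neg_cancel_right] at h2
  simpa [painleveDer] using congrArg₂ (· + ·) h1 h2

theorem component_painleveDer_frozen (n : ℤ) (f : Poly) :
    weightedHomogeneousComponent frozenScaling n (painleveDer f) =
      flow 0 (weightedHomogeneousComponent frozenScaling (n - 1) f) +
      pderiv 0 (weightedHomogeneousComponent frozenScaling n f) +
      pert (weightedHomogeneousComponent frozenScaling (n + 3) f) := by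
  have h1 := component_map (flow 0).toLinearMap hom_frozen_flow (n - 1) f
  have h2 := component_map pert.toLinearMap hom_frozen_pert (n + 3) f
  have h3 := component_map (pderiv 0).toLinearMap hom_frozen_pderiv n f
  rw [sub_add_cancel] at h1
  rw [add_neg_cancel_right] at h2
  rw [add_zero] at h3
  rw [painleveDer_eq_frozen]
  simpa using congrArg₂ (· + ·) (congrArg₂ (· + ·) h1 h3) h2

/-- The homogeneous polynomial first integrals of `y'' = 6 y ^ 2`. -/
theorem exists_eq_energy_pow {h : Poly} {n : ℤ} (hn : IsWeightedHomogeneous scaling h n)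
    (h0 : flow 1 h = 0) : h = 0 ∨ ∃ (γ : ℂ) (k : ℕ), h = C γ * energy ^ k ∧ n = 6 * k := by
  obtain ⟨-, v, hv⟩ := flow_eq_energy_mul_y (g := h) (u := 0) (by simpa using h0)
  rw [Polynomial.aeval_eq_sum_range] at hv
  simp only [smul_eq_C_mul] at hv
  have hk (k : ℕ) : IsWeightedHomogeneous scaling (C (v.coeff k) * energy ^ k) (6 * k) := by
    have := (hom_energy.pow k).C_mul (v.coeff k)
    rwa [nsmul_eq_mul, mul_comm (k : ℤ)] at this
  have hc := hn.weightedHomogeneousComponent_same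
  by_cases hex : ∃ k : ℕ, n = 6 * k
  · obtain ⟨k, rfl⟩ := hex
    by_cases hk' : k ∈ Finset.range (v.natDegree + 1)
    · refine Or.inr ⟨v.coeff k, k, ?_, rfl⟩
      conv_lhs => rw [← hc, hv, map_sum]
      rw [Finset.sum_eq_single k, (hk k).weightedHomogeneousComponent_same]
      · intro j _ hj
        exact (hk j).weightedHomogeneousComponent_ne _ (by omega)
      · exact fun h => absurd hk' h
    · left
      rw [← hc, hv, map_sum]
      refine Finset.sum_eq_zero fun j hj => (hk j).weightedHomogeneousComponent_ne _ ?_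
      have : j ≠ k := fun h => hk' (h ▸ hj)
      omega
  · left
    rw [← hc, hv, map_sum]
    refine Finset.sum_eq_zero fun j _ => (hk j).weightedHomogeneousComponent_ne _ ?_
    exact fun h => hex ⟨j, h⟩

/-! ### Darboux polynomials and first integrals. -/

theorem weight_frozenScaling (s : Fin 3 →₀ ℕ) :
    Finsupp.weight frozenScaling s = 2 * s 1 + 3 * s 2 := by
  rw [Finsupp.weight_apply, Finsupp.sum_fintype _ _ (by simp)]
  simp [Fin.sum_univ_three, frozenScaling]
  ring

/-- The weights `2i + 3j` never equal one, so `a` has weight zero; its frozen derivative would have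
weight one and hence vanishes. -/
theorem eq_ofEnergy_of_mem_weightLE {a : Poly} (ha : a ∈ weightLE frozenScaling 1) :
    IsWeightedHomogeneous frozenScaling a 0 ∧
      ∃ α : Polynomial (Polynomial ℂ), a = ofEnergy (α.map Polynomial.C) := by
  have h0 : IsWeightedHomogeneous frozenScaling a 0 := fun s hs => by
    have := ha s hs
    rw [weight_frozenScaling] at this ⊢
    omega
  have h1 : flow 0 a = 0 := by
    ext s
    by_contra hs
    have := hom_frozen_flow _ _ h0 hs
    rw [weight_frozenScaling] at this
    omega
  exact ⟨h0, (flow_zero_eq_energy (h := 0) (by simpa using h1)).2⟩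

theorem pderiv_ofEnergy (E : EnergyPoly) :
    pderiv 0 (ofEnergy E) = ofEnergy (Polynomial.derivative E) := by
  have h : pderiv 0 = flow 1 - flow 0 := by
    refine derivation_ext fun i => ?_
    fin_cases i <;> simp [pderiv_X]
  have h1 : toEnergy (pderiv 0 (ofEnergy E)) = ⟨Polynomial.derivative E, 0⟩ := by
    rw [h, Derivation.sub_apply, map_sub, toEnergy_flow, toEnergy_flow, toEnergy_ofEnergy]
    have h0 : derivY 0 = 0 := by simp [derivY]
    ext1 <;> simp [h0]
  rw [← ofEnergy_toEnergy (pderiv 0 _), h1]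
  simp

/-- A Darboux polynomial of the first Painlevé equation is a first integral. -/
theorem painleveDer_eq_zero_of_dvd {g : Poly} (hg : g ∣ painleveDer g) : painleveDer g = 0 := by
  obtain ⟨a, ha⟩ := hg
  by_cases hg0 : g = 0
  · rw [hg0, map_zero]
  obtain ⟨w, hw, hgw⟩ := exists_top_weight frozenScaling hg0
  have hcomp (n : ℤ) := component_painleveDer_frozen n g
  have hlow {n : ℤ} (h : w < n) := component_eq_zero hw h
  -- The derivation raises the weight by at most one, which bounds the weight of the cofactor.
  have ha1 : a ∈ weightLE frozenScaling 1 := by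
    by_cases ha0 : a = 0
    · rw [ha0]; exact zero_mem _
    obtain ⟨t, ht, hat⟩ := exists_top_weight frozenScaling ha0
    refine weightLE_mono (not_lt.1 fun h1 => ?_) ht
    have h2 := hcomp (w + t)
    rw [ha, ((IsLead.of_component hw).mul (IsLead.of_component ht)).component,
      hlow (n := w + t - 1) (by omega), hlow (n := w + t) (by omega),
      hlow (n := w + t + 3) (by omega)] at h2
    simp only [map_zero, add_zero, mul_eq_zero] at h2
    exact h2.elim hgw hat
  obtain ⟨ha0, α, hα⟩ := eq_ofEnergy_of_mem_weightLE ha1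
  have hag : g * a ∈ weightLE frozenScaling w := by
    simpa using mul_mem_weightLE hw (mem_weightLE_of_hom ha0)
  -- Weight `w + 1`: the frozen flow kills the top part of `g`, which is therefore a polynomial in
  -- `x` and the energy.
  have h1 := hcomp (w + 1)
  rw [ha, component_eq_zero hag (by omega), hlow (n := w + 1) (by omega),
    hlow (n := w + 1 + 3) (by omega), map_zero, map_zero, add_zero, add_zero,
    add_sub_cancel_right] at h1
  obtain ⟨-, k, hk⟩ := flow_zero_eq_energy (h := 0) (by simpa using h1.symm)
  -- Weight `w`: with `g_w` the top part, `a g_w - ∂g_w/∂x` is a frozen derivative depending only on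
  -- `x` and the energy, hence zero. The degree in `x` then forces `a = 0`.
  have h2 := hcomp w
  have h3 := ((IsLead.of_component hw).mul (IsLead.of_hom ha0)).component
  rw [add_zero] at h3
  rw [ha, h3, hlow (n := w + 3) (by omega), map_zero, add_zero] at h2
  rw [hk, pderiv_ofEnergy, hα, ← sub_eq_iff_eq_add, ← map_mul, ← map_sub,
    Polynomial.derivative_map, ← Polynomial.map_mul, ← Polynomial.map_sub] at h2
  have h4 := (flow_zero_eq_energy h2.symm).1
  have hk0 : k ≠ 0 := by
    rintro rfl
    exact hgw (by rw [hk]; simp)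
  have h5 : α = 0 := by
    by_contra hα0
    have h6 := Polynomial.degree_derivative_lt hk0
    rw [← sub_eq_zero.1 h4, Polynomial.degree_mul] at h6
    have := Polynomial.zero_le_degree_iff.2 hα0
    exact absurd h6 (not_lt.2 (le_add_of_nonneg_right this))
  rw [ha, hα, h5]
  simp

/-- The top part is `γ E^k`. Since `x y' = flow(x y) - y`, the next order makes a multiple of
`E^(k-1) y` a derivative along the flow when `k > 0`; hence `k = 0`. -/
theorem component_zero_of_painleveDer_eq_zero {g : Poly} (hg0 : g ≠ 0)
    (hg : painleveDer g = 0) :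
    ∃ γ : ℂ, weightedHomogeneousComponent scaling 0 g = C γ ∧ γ ≠ 0 := by
  obtain ⟨w, hw, hgw⟩ := exists_top_weight scaling hg0
  have hcomp (n : ℤ) := component_painleveDer n g
  simp only [hg, map_zero] at hcomp
  have h1 := hcomp (w + 1)
  rw [component_eq_zero hw (n := w + 1 + 4) (by omega), map_zero, add_zero,
    add_sub_cancel_right] at h1
  obtain h2 | ⟨γ, k, h2, hk⟩ := exists_eq_energy_pow
    (weightedHomogeneousComponent_isWeightedHomogeneous w g) h1.symm
  · exact absurd h2 hgw
  have hγ : γ ≠ 0 := by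
    rintro rfl
    exact hgw (by rw [h2]; simp)
  cases k with
  | zero => exact ⟨γ, by simpa [show w = 0 by simpa using hk] using h2, hγ⟩
  | succ k =>
    exfalso
    have h3 := hcomp (w - 4)
    rw [sub_add_cancel, h2, Derivation.leibniz, derivation_C, Derivation.leibniz_pow,
      pert_energy] at h3
    obtain ⟨β, hβ⟩ : ∃ β : ℂ, β = 2 * γ * (k + 1) := ⟨_, rfl⟩
    have hβ' : (C β : Poly) = 2 * C γ * ((k : Poly) + 1) := by
      simp only [hβ, map_mul, map_add, map_one, map_natCast, map_ofNat]
    have h4 := (flow_eq_energy_mul_y (u := Polynomial.C β * Polynomial.X ^ k)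
      (g := weightedHomogeneousComponent scaling (w - 4 - 1) g +
        C β * energy ^ k * (X 0 * X 1)) (by
        simp only [map_add, Derivation.leibniz, derivation_C, flow_energy_pow, flow_X_zero,
          flow_X_one, smul_eq_mul, map_mul, Polynomial.aeval_C, Polynomial.aeval_X, map_pow,
          algebraMap_eq, map_one]
        simp only [smul_eq_mul, nsmul_eq_mul, add_tsub_cancel_right] at h3
        push_cast at h3
        rw [hβ']
        linear_combination -h3)).1
    have h5 : β = 0 := by simpa using h4
    have hk1 : (k : ℂ) + 1 ≠ 0 := Nat.cast_add_one_ne_zero k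
    rw [h5] at hβ
    exact mul_ne_zero (mul_ne_zero two_ne_zero hγ) hk1 hβ.symm

/-- The first Painlevé equation has no nonconstant polynomial first integral. -/
theorem exists_eq_C_of_painleveDer_eq_zero {g : Poly} (hg : painleveDer g = 0) :
    ∃ γ : ℂ, g = C γ := by
  by_cases hg0 : g = 0
  · exact ⟨0, by simp [hg0]⟩
  obtain ⟨γ, hγ, -⟩ := component_zero_of_painleveDer_eq_zero hg0 hg
  refine ⟨γ, sub_eq_zero.1 ?_⟩
  -- `g - γ` is again a first integral, but its part of weight zero vanishes.
  by_contra h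
  obtain ⟨δ, hδ, hδ0⟩ := component_zero_of_painleveDer_eq_zero h
    (by rw [map_sub, hg, derivation_C, sub_zero])
  rw [map_sub, hγ, (isWeightedHomogeneous_C scaling γ).weightedHomogeneousComponent_same,
    sub_self] at hδ
  exact hδ0 (C_injective _ _ (by rw [← hδ, C_0]))

/-! ### The cubic system and its trilinear form. -/

/-- The trilinear form attached to the binary cubic form with coefficients `s, p, q, r`. -/
def tri {A : Type*} [CommRing A] (s p q r a a₁ b b₁ d d₁ : A) : A :=
  s * (a * b * d) - p * (a * b * d₁ + a * b₁ * d + a₁ * b * d) -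
    q * (a * b₁ * d₁ + a₁ * b * d₁ + a₁ * b₁ * d) - r * (a₁ * b₁ * d₁)

/-- The contraction of the trilinear form `tri` with the vector `(0, 1)`. -/
def bil {A : Type*} [CommRing A] (p q r a a₁ b b₁ : A) : A :=
  -(p * (a * b)) - q * (a * b₁ + a₁ * b) - r * (a₁ * b₁)

/-- The linear system satisfied along a solution `y` of `y'' = 6 y ^ 2 + x` by the coefficients of a
binary cubic form transported by the variational equation `v'' = 12 y v`, with forcing `f`. -/
structure IsCubicSystem {A : Type*} [CommRing A] [Algebra ℂ A] (D : Derivation ℂ A A)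
    (y f s p q r : A) : Prop where
  eq_r : D r = -3 * q
  eq_q : D q = -2 * p - 12 * y * r
  eq_p : D p = s - 24 * y * q
  eq_s : D s = 36 * y * p + f

/-- The system says that the cubic is parallel for `v'' = 12 y v` up to the forcing. On exact
variational solutions and with `f = 0`, the trilinear form is thus a first integral; the errors `η,
θ, ζ` enter through `bil`. -/
theorem IsCubicSystem.derivation_tri {A : Type*} [CommRing A] [Algebra ℂ A]
    {D : Derivation ℂ A A} {y f s p q r : A} (h : IsCubicSystem D y f s p q r)
    {a a' b b' d d' η θ ζ : A}
    (ha : D a = a') (ha' : D a' = 12 * y * a + η) (hb : D b = b') (hb' : D b' = 12 * y * b + θ)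
    (hd : D d = d') (hd' : D d' = 12 * y * d + ζ) :
    D (tri s p q r a a' b b' d d') = f * (a * b * d) + (η * bil p q r b b' d d' +
      θ * bil p q r a a' d d' + ζ * bil p q r a a' b b') := by
  simp only [tri, bil, map_sub, map_add, Derivation.leibniz, smul_eq_mul, h.eq_r, h.eq_q, h.eq_p,
    h.eq_s, ha, ha', hb, hb', hd, hd']
  ring

namespace IsLead

theorem cast {ω : Fin 3 → ℤ} {f a : Poly} {m n : ℤ} (h : IsLead ω f m a) (hmn : m = n) :
    IsLead ω f n a := hmn ▸ h

theorem painleveDer {f a : Poly} {n : ℤ} (h : IsLead scaling f n a) :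
    IsLead scaling (painleveDer f) (n + 1) (flow 1 a) := by
  have h1 := h.map (flow 1).toLinearMap hom_flow
  have h2 := of_lt (n := n + 1) (map_mem_weightLE pert.toLinearMap hom_pert h.mem) (by omega)
  simpa [PainleveFoliation.painleveDer] using h1.add h2

theorem ofNat_mul {ω : Fin 3 → ℤ} {f a : Poly} {n : ℤ} (k : ℕ) [k.AtLeastTwo]
    (h : IsLead ω f n a) :
    IsLead ω ((OfNat.ofNat k : Poly) * f) n ((OfNat.ofNat k : Poly) * a) := by
  have h' : (OfNat.ofNat k : Poly) = C (OfNat.ofNat k) := (map_ofNat C k).symm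
  rw [h']
  exact h.const_mul _

theorem tri {s p q r s₀ p₀ q₀ r₀ a a' b b' d d' a₀ a₀' b₀ b₀' d₀ d₀' : Poly} {w α β δ : ℤ}
    {ω : Fin 3 → ℤ}
    (hs : IsLead ω s (w + 3) s₀) (hp : IsLead ω p (w + 2) p₀) (hq : IsLead ω q (w + 1) q₀)
    (hr : IsLead ω r w r₀) (ha : IsLead ω a α a₀) (ha' : IsLead ω a' (α + 1) a₀')
    (hb : IsLead ω b β b₀) (hb' : IsLead ω b' (β + 1) b₀')
    (hd : IsLead ω d δ d₀) (hd' : IsLead ω d' (δ + 1) d₀') :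
    IsLead ω (tri s p q r a a' b b' d d') (w + 3 + α + β + δ)
      (PainleveFoliation.tri s₀ p₀ q₀ r₀ a₀ a₀' b₀ b₀' d₀ d₀') := by
  have h1 := (hs.mul ((ha.mul hb).mul hd)).cast
    (show _ = w + 3 + α + β + δ by ring)
  have h2 := (hp.mul ((((ha.mul hb).mul hd').cast (show _ = α + β + δ + 1 by ring)).add
    (((ha.mul hb').mul hd).cast (by ring)) |>.add (((ha'.mul hb).mul hd).cast (by ring)))).cast
    (show _ = w + 3 + α + β + δ by ring)
  have h3 := (hq.mul ((((ha.mul hb').mul hd').cast (show _ = α + β + δ + 2 by ring)).add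
    (((ha'.mul hb).mul hd').cast (by ring)) |>.add (((ha'.mul hb').mul hd).cast (by ring)))).cast
    (show _ = w + 3 + α + β + δ by ring)
  have h4 := (hr.mul ((ha'.mul hb').mul hd')).cast (show _ = w + 3 + α + β + δ by ring)
  exact ((h1.sub h2).sub h3).sub h4

theorem bil {p q r p₀ q₀ r₀ a a' b b' a₀ a₀' b₀ b₀' : Poly} {w α β : ℤ}
    {ω : Fin 3 → ℤ} (hp : IsLead ω p (w + 2) p₀) (hq : IsLead ω q (w + 1) q₀)
    (hr : IsLead ω r w r₀) (ha : IsLead ω a α a₀) (ha' : IsLead ω a' (α + 1) a₀')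
    (hb : IsLead ω b β b₀) (hb' : IsLead ω b' (β + 1) b₀') :
    IsLead ω (bil p q r a a' b b') (w + 2 + α + β)
      (PainleveFoliation.bil p₀ q₀ r₀ a₀ a₀' b₀ b₀') := by
  have h1 := (hp.mul (ha.mul hb)).cast (show _ = w + 2 + α + β by ring)
  have h2 := (hq.mul (((ha.mul hb').cast (show _ = α + β + 1 by ring)).add
    ((ha'.mul hb).cast (by ring)))).cast (show _ = w + 2 + α + β by ring)
  have h3 := (hr.mul (ha'.mul hb')).cast (show _ = w + 2 + α + β by ring)
  exact (h1.neg.sub h2).sub h3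

end IsLead

/-! ### The unforced system along the autonomous flow. -/

/-- The solution of the variational equation of `y'' = 6 y ^ 2` given by the scaling symmetry. -/
def scalingField : Poly := X 0 * X 2 + 2 * X 1

theorem hom_scalingField : IsWeightedHomogeneous scaling scalingField 2 := by
  have := (hom_X_zero.mul hom_X_two).add (hom_ofNat_mul 2 hom_X_one)
  simpa [scalingField] using this

theorem flow_scalingField : flow 1 scalingField = 3 * X 2 + 6 * X 0 * X 1 ^ 2 := by
  simp [scalingField, Derivation.leibniz, derivation_ofNat]
  ring

theorem flow_flow_X_two : flow 1 (flow 1 (X 2)) = 12 * X 1 * X 2 + 0 := by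
  simp [Derivation.leibniz, Derivation.leibniz_pow, derivation_ofNat]
  ring

theorem flow_flow_scalingField : flow 1 (flow 1 scalingField) = 12 * X 1 * scalingField + 0 := by
  rw [flow_scalingField]
  simp [scalingField, Derivation.leibniz, Derivation.leibniz_pow, derivation_ofNat]
  ring

/-- Along the full equation `y'` and `x y' + 2y` solve the variational equation only up to `1` and
`5x`, five weights lower; these errors produce the first-order obstruction. -/
theorem painleveDer_painleveDer_X_two :
    painleveDer (painleveDer (X 2)) = 12 * X 1 * X 2 + 1 := by
  simp [Derivation.leibniz, Derivation.leibniz_pow, derivation_ofNat]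
  ring

theorem painleveDer_scalingField :
    painleveDer scalingField = 3 * X 2 + 6 * X 0 * X 1 ^ 2 + X 0 ^ 2 := by
  simp [scalingField, Derivation.leibniz, derivation_ofNat]
  ring

theorem painleveDer_painleveDer_scalingField :
    painleveDer (painleveDer scalingField) = 12 * X 1 * scalingField + 5 * X 0 := by
  rw [painleveDer_scalingField]
  simp [scalingField, Derivation.leibniz, Derivation.leibniz_pow, derivation_ofNat]
  ring

theorem wronskian_eq :
    X 2 * flow 1 scalingField - flow 1 (X 2) * scalingField = 3 * energy := by
  rw [flow_scalingField]
  simp [scalingField, energy]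
  ring

/-- At `(0, 1, 2)` the energy vanishes while `y'` and `x y' + 2y` both equal `2`, so the energy does
not divide their monomials. -/
theorem three_le_of_energy_pow {r : Poly} {δ : ℂ} {m i j : ℕ} (hδ : δ ≠ 0)
    (h : 27 * energy ^ 3 * r = C δ * energy ^ m * (X 2 ^ i * scalingField ^ j)) : 3 ≤ m := by
  by_contra hm
  have hm' : energy ^ 3 = energy ^ m * energy ^ (2 - m) * energy := by
    rw [← pow_add, ← pow_succ]
    congr 1
    omega
  have h1 : 27 * energy ^ (2 - m) * energy * r = C δ * (X 2 ^ i * scalingField ^ j) := by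
    refine mul_left_cancel₀ (pow_ne_zero m energy_ne_zero) ?_
    rw [hm'] at h
    linear_combination h
  have h2 := congrArg (eval ![0, 1, 2]) h1
  have h3 : eval ![0, 1, 2] energy = (0 : ℂ) := by
    simp [energy]
    norm_num
  rw [map_mul, map_mul, h3, mul_zero, zero_mul] at h2
  simp [scalingField, hδ] at h2

section Kernel

variable {s p q r : Poly} {w : ℤ}

/-- With `v = x y' + 2y`, the vector `y'·(v, v') - v·(y', y'')` equals `(0, 3E)`; put it in all
three slots of the trilinear form. -/
theorem energy_pow_mul_eq (s p q r : Poly) :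
    27 * energy ^ 3 * r =
      scalingField ^ 3 * tri s p q r (X 2) (flow 1 (X 2)) (X 2) (flow 1 (X 2))
        (X 2) (flow 1 (X 2)) -
      3 * scalingField ^ 2 * X 2 * tri s p q r (X 2) (flow 1 (X 2)) (X 2) (flow 1 (X 2))
        scalingField (flow 1 scalingField) +
      3 * scalingField * X 2 ^ 2 * tri s p q r (X 2) (flow 1 (X 2))
        scalingField (flow 1 scalingField) scalingField (flow 1 scalingField) -
      X 2 ^ 3 * tri s p q r scalingField (flow 1 scalingField)
        scalingField (flow 1 scalingField) scalingField (flow 1 scalingField) := by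
  have h : 27 * energy ^ 3 * r =
      (X 2 * flow 1 scalingField - flow 1 (X 2) * scalingField) ^ 3 * r := by
    rw [wronskian_eq]
    ring
  rw [h]
  simp only [tri]
  ring

theorem tri_eq_zero_or {a b d : Poly} {α β δ : ℤ}
    (h : IsCubicSystem (flow 1) (X 1) 0 s p q r)
    (hs : IsWeightedHomogeneous scaling s (w + 3)) (hp : IsWeightedHomogeneous scaling p (w + 2))
    (hq : IsWeightedHomogeneous scaling q (w + 1)) (hr : IsWeightedHomogeneous scaling r w)
    (ha : IsWeightedHomogeneous scaling a α) (hb : IsWeightedHomogeneous scaling b β)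
    (hd : IsWeightedHomogeneous scaling d δ)
    (ha' : flow 1 (flow 1 a) = 12 * X 1 * a + 0) (hb' : flow 1 (flow 1 b) = 12 * X 1 * b + 0)
    (hd' : flow 1 (flow 1 d) = 12 * X 1 * d + 0) :
    tri s p q r a (flow 1 a) b (flow 1 b) d (flow 1 d) = 0 ∨ ∃ (γ : ℂ) (k : ℕ),
      tri s p q r a (flow 1 a) b (flow 1 b) d (flow 1 d) = C γ * energy ^ k ∧
        w + 3 + α + β + δ = 6 * k := by
  refine exists_eq_energy_pow (IsLead.tri (.of_hom hs) (.of_hom hp) (.of_hom hq) (.of_hom hr)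
    (.of_hom ha) (.of_hom (hom_flow _ _ ha)) (.of_hom hb) (.of_hom (hom_flow _ _ hb))
    (.of_hom hd) (.of_hom (hom_flow _ _ hd))).hom ?_
  rw [h.derivation_tri rfl ha' rfl hb' rfl hd']
  ring

/-- A nonzero homogeneous solution of the unforced cubic system has exactly one nonzero
coefficient in the basis of cubic forms attached to the two variational solutions. -/
theorem exists_tri_eq (h : IsCubicSystem (flow 1) (X 1) 0 s p q r)
    (hs : IsWeightedHomogeneous scaling s (w + 3)) (hp : IsWeightedHomogeneous scaling p (w + 2))
    (hq : IsWeightedHomogeneous scaling q (w + 1)) (hr : IsWeightedHomogeneous scaling r w)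
    (hr0 : r ≠ 0) {T₀ T₁ T₂ T₃ : Poly}
    (hT₀ : tri s p q r (X 2) (flow 1 (X 2)) (X 2) (flow 1 (X 2)) (X 2) (flow 1 (X 2)) = T₀)
    (hT₁ : tri s p q r (X 2) (flow 1 (X 2)) (X 2) (flow 1 (X 2))
      scalingField (flow 1 scalingField) = T₁)
    (hT₂ : tri s p q r (X 2) (flow 1 (X 2)) scalingField (flow 1 scalingField)
      scalingField (flow 1 scalingField) = T₂)
    (hT₃ : tri s p q r scalingField (flow 1 scalingField) scalingField (flow 1 scalingField)
      scalingField (flow 1 scalingField) = T₃) :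
    ∃ (γ : ℂ) (m : ℕ), γ ≠ 0 ∧ 3 ≤ m ∧
      ((T₀ = C γ * energy ^ m ∧ T₁ = 0 ∧ T₂ = 0 ∧ T₃ = 0 ∧ w + 12 = 6 * m) ∨
      (T₀ = 0 ∧ T₁ = C γ * energy ^ m ∧ T₂ = 0 ∧ T₃ = 0 ∧ w + 11 = 6 * m) ∨
      (T₀ = 0 ∧ T₁ = 0 ∧ T₂ = C γ * energy ^ m ∧ T₃ = 0 ∧ w + 10 = 6 * m) ∨
      (T₀ = 0 ∧ T₁ = 0 ∧ T₂ = 0 ∧ T₃ = C γ * energy ^ m ∧ w + 9 = 6 * m)) := by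
  have hid := energy_pow_mul_eq s p q r
  have h0 := tri_eq_zero_or h hs hp hq hr hom_X_two hom_X_two hom_X_two flow_flow_X_two
    flow_flow_X_two flow_flow_X_two
  have h1 := tri_eq_zero_or h hs hp hq hr hom_X_two hom_X_two hom_scalingField flow_flow_X_two
    flow_flow_X_two flow_flow_scalingField
  have h2 := tri_eq_zero_or h hs hp hq hr hom_X_two hom_scalingField hom_scalingField
    flow_flow_X_two flow_flow_scalingField flow_flow_scalingField
  have h3 := tri_eq_zero_or h hs hp hq hr hom_scalingField hom_scalingField hom_scalingField
    flow_flow_scalingField flow_flow_scalingField flow_flow_scalingField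
  rw [hT₀] at hid h0
  rw [hT₁] at hid h1
  rw [hT₂] at hid h2
  rw [hT₃] at hid h3
  have hne : 27 * energy ^ 3 * r ≠ 0 :=
    mul_ne_zero (mul_ne_zero (by norm_num) (pow_ne_zero 3 energy_ne_zero)) hr0
  have key {γ δ : ℂ} {m i j : ℕ} (hγ : γ = 0 → δ = 0)
      (hm : 27 * energy ^ 3 * r = C δ * energy ^ m * (X 2 ^ i * scalingField ^ j)) :
      γ ≠ 0 ∧ 3 ≤ m := by
    have hδ : δ ≠ 0 := by
      rintro rfl
      exact hne (by rw [hm]; simp)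
    exact ⟨fun h => hδ (hγ h), three_le_of_energy_pow hδ hm⟩
  -- The weights `w + 12, …, w + 9` contain at most one multiple of six, so `omega` removes every
  -- case with two powers of the energy.
  obtain h0 | ⟨γ₀, k₀, h0, hk₀⟩ := h0 <;> obtain h1 | ⟨γ₁, k₁, h1, hk₁⟩ := h1 <;>
    obtain h2 | ⟨γ₂, k₂, h2, hk₂⟩ := h2 <;> obtain h3 | ⟨γ₃, k₃, h3, hk₃⟩ := h3 <;>
    first
    | omega
    | (rw [h0, h1, h2, h3] at hid)
  · exact absurd hid (by simpa using hne)
  · obtain ⟨hγ, hm⟩ := key (γ := γ₃) (δ := -γ₃) (m := k₃) (i := 3) (j := 0) (by simp)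
      (by rw [hid, C_neg]; ring)
    exact ⟨γ₃, k₃, hγ, hm, .inr (.inr (.inr ⟨h0, h1, h2, h3, by omega⟩))⟩
  · obtain ⟨hγ, hm⟩ := key (γ := γ₂) (δ := 3 * γ₂) (m := k₂) (i := 2) (j := 1) (by simp)
      (by rw [hid, C_mul, map_ofNat]; ring)
    exact ⟨γ₂, k₂, hγ, hm, .inr (.inr (.inl ⟨h0, h1, h2, h3, by omega⟩))⟩
  · obtain ⟨hγ, hm⟩ := key (γ := γ₁) (δ := -3 * γ₁) (m := k₁) (i := 1) (j := 2) (by simp)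
      (by rw [hid, C_mul, C_neg, map_ofNat]; ring)
    exact ⟨γ₁, k₁, hγ, hm, .inr (.inl ⟨h0, h1, h2, h3, by omega⟩)⟩
  · obtain ⟨hγ, hm⟩ := key (γ := γ₀) (δ := γ₀) (m := k₀) (i := 0) (j := 3) (by simp)
      (by rw [hid]; ring)
    exact ⟨γ₀, k₀, hγ, hm, .inl ⟨h0, h1, h2, h3, by omega⟩⟩

end Kernel

/-! ### The first-order obstruction and polynomial solutions. -/

/-- The obstruction to extending a leading term past the first order of the perturbation. -/
theorem obstruction_eq_zero {J R₀ : Poly} {γ : ℂ} {m : ℕ} {A B : ℤ} (hγ : γ ≠ 0)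
    (hJ : IsLead scaling J (6 * ((m + 1 : ℕ) : ℤ)) (C γ * energy ^ (m + 1)))
    (hD : IsLead scaling (painleveDer J) (6 * (m : ℤ) + 2) R₀)
    (hR : 3 * energy * R₀ =
      C γ * energy ^ (m + 1) * ((A : Poly) * (X 0 * X 2) + (B : Poly) * X 1)) :
    6 * ((m : ℤ) + 1) - A + B = 0 := by
  have h1 := hD.component
  rw [component_painleveDer, show 6 * (m : ℤ) + 2 + 4 = 6 * ((m + 1 : ℕ) : ℤ) by push_cast; ring,
    hJ.component, Derivation.leibniz, derivation_C, Derivation.leibniz_pow, pert_energy] at h1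
  simp only [smul_eq_mul, nsmul_eq_mul, add_tsub_cancel_right] at h1
  push_cast at h1
  set J' := weightedHomogeneousComponent scaling (6 * (m : ℤ) + 2 - 1) J
  have hR' : 3 * R₀ = C γ * energy ^ m * ((A : Poly) * (X 0 * X 2) + (B : Poly) * X 1) := by
    refine mul_left_cancel₀ energy_ne_zero ?_
    linear_combination hR
  obtain ⟨δ, hδ⟩ : ∃ δ : ℂ, δ = γ * (A - 6 * (m + 1)) := ⟨_, rfl⟩
  obtain ⟨ε, hε⟩ : ∃ ε : ℂ, ε = γ * (6 * (m + 1) - A + B) := ⟨_, rfl⟩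
  have hδ' : (C δ : Poly) = C γ * ((A : Poly) - 6 * ((m : Poly) + 1)) := by
    simp only [hδ, map_mul, map_sub, map_add, map_one, map_natCast, map_intCast, map_ofNat]
  have hε' : (C ε : Poly) = C γ * (6 * ((m : Poly) + 1) - (A : Poly) + (B : Poly)) := by
    simp only [hε, map_mul, map_sub, map_add, map_one, map_natCast, map_intCast, map_ofNat]
  -- Replacing `x y'` by `flow(x y) - y` leaves `ε E^m y` as a derivative along the flow.
  have h4 := (flow_eq_energy_mul_y (u := Polynomial.C ε * Polynomial.X ^ m)
    (g := 3 * J' - C δ * energy ^ m * (X 0 * X 1)) (by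
      simp only [map_sub, Derivation.leibniz, derivation_C, flow_energy_pow, flow_X_zero,
        flow_X_one, smul_eq_mul, map_mul, Polynomial.aeval_C, Polynomial.aeval_X, map_pow,
        algebraMap_eq, map_one, derivation_ofNat]
      rw [hδ', hε']
      linear_combination 3 * h1 + hR')).1
  have h5 : ε = 0 := by simpa using h4
  rw [h5] at hε
  have h6 := (mul_eq_zero.1 hε.symm).resolve_left hγ
  exact_mod_cast h6

/-- Here `(0, 3E) = y'·(v, v') - v·(y', y'')` is put in a single slot of the trilinear form. -/
theorem energy_mul_bil {s p q r : Poly} :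
    3 * energy * bil p q r (X 2) (flow 1 (X 2)) (X 2) (flow 1 (X 2)) =
      X 2 * tri s p q r (X 2) (flow 1 (X 2)) (X 2) (flow 1 (X 2))
        scalingField (flow 1 scalingField) -
      scalingField * tri s p q r (X 2) (flow 1 (X 2)) (X 2) (flow 1 (X 2))
        (X 2) (flow 1 (X 2)) ∧
    3 * energy * bil p q r (X 2) (flow 1 (X 2)) scalingField (flow 1 scalingField) =
      X 2 * tri s p q r (X 2) (flow 1 (X 2)) scalingField (flow 1 scalingField)
        scalingField (flow 1 scalingField) -
      scalingField * tri s p q r (X 2) (flow 1 (X 2)) (X 2) (flow 1 (X 2))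
        scalingField (flow 1 scalingField) ∧
    3 * energy * bil p q r scalingField (flow 1 scalingField)
        scalingField (flow 1 scalingField) =
      X 2 * tri s p q r scalingField (flow 1 scalingField) scalingField (flow 1 scalingField)
        scalingField (flow 1 scalingField) -
      scalingField * tri s p q r (X 2) (flow 1 (X 2)) scalingField (flow 1 scalingField)
        scalingField (flow 1 scalingField) := by
  rw [← wronskian_eq]
  simp only [tri, bil]
  refine ⟨?_, ?_, ?_⟩ <;> ring

/-- The leading terms of a solution of the cubic system along the first Painlevé equation. -/
theorem IsCubicSystem.exists_lead {f s p q r r₀ : Poly} {w : ℤ}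
    (h : IsCubicSystem painleveDer (X 1) f s p q r) (hr : IsLead scaling r w r₀) :
    ∃ s₀ p₀ q₀, IsLead scaling s (w + 3) s₀ ∧ IsLead scaling p (w + 2) p₀ ∧
      IsLead scaling q (w + 1) q₀ ∧ IsCubicSystem (flow 1) (X 1)
        (weightedHomogeneousComponent scaling (w + 4) f) s₀ p₀ q₀ r₀ := by
  have hX := IsLead.of_hom hom_X_one
  have h3 : (C (-1 / 3) : Poly) * 3 = -1 := by
    rw [show (3 : Poly) = C 3 from (map_ofNat C 3).symm, ← C_mul,
      show (-1 : Poly) = C (-1) by simp]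
    norm_num
  have h2 : (C (-1 / 2) : Poly) * 2 = -1 := by
    rw [show (2 : Poly) = C 2 from (map_ofNat C 2).symm, ← C_mul,
      show (-1 : Poly) = C (-1) by simp]
    norm_num
  -- The system determines `q`, `p`, `s` and `f` successively from `r`, and their leading terms
  -- likewise.
  have hq : IsLead scaling q (w + 1) (C (-1 / 3) * flow 1 r₀) := by
    rw [show q = C (-1 / 3) * painleveDer r by
      rw [h.eq_r]; linear_combination q * h3]
    exact hr.painleveDer.const_mul _
  set q₀ := C (-1 / 3) * flow 1 r₀ with hq₀
  have hp : IsLead scaling p (w + 2) (C (-1 / 2) * (flow 1 q₀ + 12 * (X 1 * r₀))) := by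
    rw [show p = C (-1 / 2) * (painleveDer q + 12 * (X 1 * r)) by
      rw [h.eq_q]; linear_combination p * h2]
    exact ((hq.painleveDer.cast (show _ = w + 2 by ring)).add
      (((hX.mul hr).ofNat_mul 12).cast (by ring))).const_mul _
  set p₀ := C (-1 / 2) * (flow 1 q₀ + 12 * (X 1 * r₀)) with hp₀
  have hs : IsLead scaling s (w + 3) (flow 1 p₀ + 24 * (X 1 * q₀)) := by
    rw [show s = painleveDer p + 24 * (X 1 * q) by rw [h.eq_p]; ring]
    exact (hp.painleveDer.cast (show _ = w + 3 by ring)).add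
      (((hX.mul hq).ofNat_mul 24).cast (by ring))
  set s₀ := flow 1 p₀ + 24 * (X 1 * q₀) with hs₀
  refine ⟨s₀, p₀, q₀, hs, hp, hq, ?_, ?_, ?_, ?_⟩
  · linear_combination flow 1 r₀ * h3 + 3 * hq₀
  · linear_combination (flow 1 q₀ + 12 * (X 1 * r₀)) * h2 + 2 * hp₀
  · linear_combination -hs₀
  · have hf : IsLead scaling f (w + 4) (flow 1 s₀ - 36 * (X 1 * p₀)) := by
      rw [show f = painleveDer s - 36 * (X 1 * p) by rw [h.eq_s]; ring]
      exact (hs.painleveDer.cast (show _ = w + 4 by ring)).sub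
        (((hX.mul hp).ofNat_mul 36).cast (by ring))
    rw [hf.component]
    ring

/-- The unforced leading system has no solution compatible with the first order of the
perturbation. -/
theorem IsCubicSystem.lead_eq_zero {s p q r s₀ p₀ q₀ r₀ : Poly} {w : ℤ}
    (h : IsCubicSystem painleveDer (X 1) 12 s p q r)
    (hs : IsLead scaling s (w + 3) s₀) (hp : IsLead scaling p (w + 2) p₀)
    (hq : IsLead scaling q (w + 1) q₀) (hr : IsLead scaling r w r₀)
    (h₀ : IsCubicSystem (flow 1) (X 1) 0 s₀ p₀ q₀ r₀) : r₀ = 0 := by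
  by_contra hr0
  obtain ⟨γ, m, hγ, hm, H⟩ := exists_tri_eq h₀ hs.hom hp.hom hq.hom hr.hom hr0 rfl rfl rfl rfl
  obtain ⟨m, rfl⟩ : ∃ k, m = k + 1 := ⟨m - 1, by omega⟩
  obtain ⟨hzz, hzv, hvv⟩ := energy_mul_bil (s := s₀) (p := p₀) (q := q₀) (r := r₀)
  have hz := IsLead.of_hom hom_X_two
  have hv := IsLead.of_hom hom_scalingField
  have hx := IsLead.of_hom hom_X_zero
  have hz' := hz.painleveDer
  have hv' := hv.painleveDer
  have Bzz := IsLead.bil hp hq hr hz hz' hz hz'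
  have Bzv := IsLead.bil hp hq hr hz hz' hv hv'
  have Bvv := IsLead.bil hp hq hr hv hv' hv hv'
  -- After the shift `m ≥ 2`, and the forcing term has weight at most `9 < 6m + 2`.
  have low {v : Poly} {n : ℤ} (hn : n < 6 * (m : ℤ) + 2) (hv : IsWeightedHomogeneous scaling v n) :
      IsLead scaling (12 * v) (6 * (m : ℤ) + 2) 0 :=
    IsLead.of_lt (mem_weightLE_of_hom (hom_ofNat_mul 12 hv)) hn
  have hV : scalingField = X 0 * X 2 + 2 * X 1 := rfl
  -- In each case `A` and `B` collect the three `bil` terms, weighted by the errors `1` or `5x`. The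
  -- obstruction reads `6m = -3, 1, 5, 9` respectively, impossible for an integer `m`.
  rcases H with ⟨e0, e1, e2, e3, hw⟩ | ⟨e0, e1, e2, e3, hw⟩ | ⟨e0, e1, e2, e3, hw⟩ |
    ⟨e0, e1, e2, e3, hw⟩ <;> rw [e0, e1] at hzz <;> rw [e1, e2] at hzv <;> rw [e2, e3] at hvv
  · have hJ := (IsLead.tri hs hp hq hr hz hz' hz hz' hz hz').cast
      (show _ = 6 * ((m + 1 : ℕ) : ℤ) by omega)
    rw [e0] at hJ
    have hD := h.derivation_tri rfl painleveDer_painleveDer_X_two rfl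
      painleveDer_painleveDer_X_two rfl painleveDer_painleveDer_X_two
    have hB := Bzz.cast (show _ = 6 * (m : ℤ) + 2 by omega)
    have hR := (low (by omega) ((hom_X_two.mul hom_X_two).mul hom_X_two)).add
      ((hB.add hB).add hB)
    have := obstruction_eq_zero (A := -3) (B := -6) hγ hJ
      (by rw [hD]; simpa only [one_mul] using hR)
      (by rw [zero_add, mul_add, mul_add, hzz, hV]; push_cast; ring)
    omega
  · have hJ := (IsLead.tri hs hp hq hr hz hz' hz hz' hv hv').cast
      (show _ = 6 * ((m + 1 : ℕ) : ℤ) by omega)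
    rw [e1] at hJ
    have hD := h.derivation_tri rfl painleveDer_painleveDer_X_two rfl
      painleveDer_painleveDer_X_two rfl painleveDer_painleveDer_scalingField
    have hB := Bzv.cast (show _ = 6 * (m : ℤ) + 2 by omega)
    have hB' := ((hx.ofNat_mul 5).mul Bzz).cast (show _ = 6 * (m : ℤ) + 2 by omega)
    have hR := (low (by omega) ((hom_X_two.mul hom_X_two).mul hom_scalingField)).add
      ((hB.add hB).add hB')
    have := obstruction_eq_zero (A := 3) (B := -4) hγ hJ
      (by rw [hD]; simpa only [one_mul] using hR)
      (by
        push_cast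
        linear_combination 2 * hzv + 5 * X 0 * hzz - 2 * (C γ * energy ^ (m + 1)) * hV)
    omega
  · have hJ := (IsLead.tri hs hp hq hr hz hz' hv hv' hv hv').cast
      (show _ = 6 * ((m + 1 : ℕ) : ℤ) by omega)
    rw [e2] at hJ
    have hD := h.derivation_tri rfl painleveDer_painleveDer_X_two rfl
      painleveDer_painleveDer_scalingField rfl painleveDer_painleveDer_scalingField
    have hB := Bvv.cast (show _ = 6 * (m : ℤ) + 2 by omega)
    have hB' := ((hx.ofNat_mul 5).mul Bzv).cast (show _ = 6 * (m : ℤ) + 2 by omega)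
    have hR := (low (by omega) ((hom_X_two.mul hom_scalingField).mul hom_scalingField)).add
      ((hB.add hB').add hB')
    have := obstruction_eq_zero (A := 9) (B := -2) hγ hJ
      (by rw [hD]; simpa only [one_mul] using hR)
      (by
        push_cast
        linear_combination hvv + 10 * X 0 * hzv - C γ * energy ^ (m + 1) * hV)
    omega
  · have hJ := (IsLead.tri hs hp hq hr hv hv' hv hv' hv hv').cast
      (show _ = 6 * ((m + 1 : ℕ) : ℤ) by omega)
    rw [e3] at hJ
    have hD := h.derivation_tri rfl painleveDer_painleveDer_scalingField rfl
      painleveDer_painleveDer_scalingField rfl painleveDer_painleveDer_scalingField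
    have hB' := ((hx.ofNat_mul 5).mul Bvv).cast (show _ = 6 * (m : ℤ) + 2 by omega)
    have hR := (low (by omega) ((hom_scalingField.mul hom_scalingField).mul
      hom_scalingField)).add ((hB'.add hB').add hB')
    have := obstruction_eq_zero (A := 15) (B := 0) hγ hJ
      (by rw [hD]; exact hR)
      (by
        push_cast
        linear_combination 15 * X 0 * hvv)
    omega

/-- The forced system has the particular solution `(12 y y', 10y²/3, 2y'/9, -2y/3) / E`. Subtracting
it and multiplying by `9E` gives an unforced polynomial solution of weight `2`, nonzero because its
last entry is `6y` on `E = 0`. Then `6m` is one of `14, 13, 12, 11`, against `m ≥ 3`. -/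
theorem IsCubicSystem.not_homogeneous {s p q r : Poly} {w : ℤ}
    (h : IsCubicSystem (flow 1) (X 1) 12 s p q r) (hw : w = -4)
    (hs : IsWeightedHomogeneous scaling s (w + 3)) (hp : IsWeightedHomogeneous scaling p (w + 2))
    (hq : IsWeightedHomogeneous scaling q (w + 1)) (hr : IsWeightedHomogeneous scaling r w) :
    False := by
  have he (n : ℤ) {f : Poly} {m : ℤ} (hf : IsWeightedHomogeneous scaling f m) (hn : 6 + m = n) :
      IsWeightedHomogeneous scaling (9 * (energy * f)) n :=
    hn ▸ hom_ofNat_mul 9 (hom_energy.mul hf)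
  have h' : IsCubicSystem (flow 1) (X 1) 0 (9 * (energy * s) - 108 * (X 1 * X 2))
      (9 * (energy * p) - 30 * X 1 ^ 2) (9 * (energy * q) - 2 * X 2)
      (9 * (energy * r) + 6 * X 1) := by
    constructor <;> simp only [map_sub, map_add, Derivation.leibniz, Derivation.leibniz_pow,
      smul_eq_mul, nsmul_eq_mul, derivation_ofNat, flow_energy, flow_X_one, flow_X_two, h.eq_s,
      h.eq_p, h.eq_q, h.eq_r]
    · ring
    · ring
    · push_cast; ring
    · rw [energy]; ring
  have hr' : 9 * (energy * r) + 6 * X 1 ≠ 0 := fun h0 => by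
    have h3 : eval ![0, 1, 2] energy = (0 : ℂ) := by
      simp [energy]
      norm_num
    have h2 := congrArg (eval ![0, 1, 2]) h0
    rw [map_add, map_mul, map_mul, h3] at h2
    simp at h2
  obtain ⟨γ, m, -, hm, H⟩ := exists_tri_eq (w := 2) h'
    ((he _ hs (by omega)).sub (hom_ofNat_mul 108 (hom_X_one.mul hom_X_two)))
    ((he _ hp (by omega)).sub (hom_ofNat_mul 30 (hom_X_one.pow 2)))
    ((he _ hq (by omega)).sub (hom_ofNat_mul 2 hom_X_two))
    ((he _ hr (by omega)).add (hom_ofNat_mul 6 hom_X_one)) hr' rfl rfl rfl rfl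
  omega

/-- The cubic system along the first Painlevé equation has no polynomial solution. -/
theorem not_isCubicSystem_polynomial {s p q r : Poly} :
    ¬ IsCubicSystem painleveDer (X 1) 12 s p q r := by
  intro h
  have hr0 : r ≠ 0 := by
    rintro rfl
    have hq : q = 0 := by simpa using h.eq_r
    subst hq
    have hp : p = 0 := by simpa using h.eq_q
    subst hp
    have hs : s = 0 := by simpa using h.eq_p.symm
    subst hs
    simpa using h.eq_s
  obtain ⟨w, hw, hrw⟩ := exists_top_weight scaling hr0
  obtain ⟨s₀, p₀, q₀, hs, hp, hq, h₀⟩ := h.exists_lead (IsLead.of_component hw)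
  have h12 : IsWeightedHomogeneous scaling (12 : Poly) 0 := by
    rw [show (12 : Poly) = C 12 from (map_ofNat C 12).symm]
    exact isWeightedHomogeneous_C scaling 12
  -- The constant forcing has weight zero, so it reaches the leading system only when `w + 4 = 0`.
  by_cases hw4 : w = -4
  · rw [show w + 4 = 0 by omega, h12.weightedHomogeneousComponent_same] at h₀
    exact h₀.not_homogeneous hw4 hs.hom hp.hom hq.hom (IsLead.of_component hw).hom
  · rw [h12.weightedHomogeneousComponent_ne _ (by omega)] at h₀
    exact hrw (h.lead_eq_zero hs hp hq (IsLead.of_component hw) h₀)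

end PainleveFoliation
end

noncomputable section
namespace PainleveFoliation

/-! ### From algebraic to rational to polynomial solutions. -/

theorem derivation_algFun_ext {D₁ D₂ : Derivation ℂ AlgFun AlgFun}
    (h : ∀ i, D₁ (coord i) = D₂ (coord i)) : D₁ = D₂ := by
  have h1 : D₁.liftKaehlerDifferential = D₂.liftKaehlerDifferential :=
    diffBasis.ext fun i => by
      rw [diffBasis_apply, Derivation.liftKaehlerDifferential_comp_D,
        Derivation.liftKaehlerDifferential_comp_D, h]
  rw [← D₁.liftKaehlerDifferential_comp, ← D₂.liftKaehlerDifferential_comp, h1]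

/-- The derivation of algebraic functions given by the vector field of the first Painlevé
equation. -/
def algDer : Derivation ℂ AlgFun AlgFun :=
  partialDeriv 0 + coord 2 • partialDeriv 1 + (6 * coord 1 ^ 2 + coord 0) • partialDeriv 2

theorem algDer_apply (f : AlgFun) : algDer f = partialDeriv 0 f + coord 2 * partialDeriv 1 f +
    (6 * coord 1 ^ 2 + coord 0) * partialDeriv 2 f := rfl

theorem algDer_algebraMap (f : Poly) :
    algDer (algebraMap Poly AlgFun f) = algebraMap Poly AlgFun (painleveDer f) := by
  have h : algDer.compAlgebraMap Poly = (Algebra.linearMap Poly AlgFun).compDer painleveDer := by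
    refine MvPolynomial.derivation_ext fun i => ?_
    change algDer (coord i) = algebraMap Poly AlgFun (painleveDer (MvPolynomial.X i))
    have h6 : algebraMap Poly AlgFun 6 = 6 := map_ofNat _ 6
    rw [algDer_apply, partialDeriv_coord, partialDeriv_coord, partialDeriv_coord]
    fin_cases i <;> simp [coord, h6]
  exact congrArg (fun d => d f) h

/-- The conjugate `σ⁻¹ ∘ algDer ∘ σ` is a derivation with the same values on the coordinates. -/
theorem algDer_algEquiv (σ : AlgFun ≃ₐ[RatFun] AlgFun) (f : AlgFun) :
    algDer (σ f) = σ (algDer f) := by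
  have hσ (i : Fin 3) : σ (coord i) = coord i := by
    rw [coord, IsScalarTower.algebraMap_apply Poly RatFun AlgFun, σ.commutes]
  let E : Derivation ℂ AlgFun AlgFun := Derivation.mk'
    ((σ.symm.restrictScalars ℂ).toLinearMap ∘ₗ algDer.toLinearMap ∘ₗ
      (σ.restrictScalars ℂ).toLinearMap) fun a b => by
      change σ.symm (algDer (σ (a * b))) = a * σ.symm (algDer (σ b)) + b * σ.symm (algDer (σ a))
      simp [Derivation.leibniz]
  have hE : E = algDer := derivation_algFun_ext fun i => by
    change σ.symm (algDer (σ (coord i))) = algDer (coord i)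
    rw [hσ, coord, algDer_algebraMap, IsScalarTower.algebraMap_apply Poly RatFun AlgFun,
      σ.symm.commutes]
  have h : E f = σ.symm (algDer (σ f)) := rfl
  rw [hE] at h
  rw [h, AlgEquiv.apply_symm_apply]

theorem algDer_mem_fieldRange {f : AlgFun} (hf : f ∈ (algebraMap RatFun AlgFun).fieldRange) :
    algDer f ∈ (algebraMap RatFun AlgFun).fieldRange := by
  have hP (a : Poly) : algebraMap Poly AlgFun a ∈ (algebraMap RatFun AlgFun).fieldRange :=
    ⟨algebraMap Poly RatFun a, (IsScalarTower.algebraMap_apply Poly RatFun AlgFun a).symm⟩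
  obtain ⟨g, rfl⟩ := hf
  obtain ⟨a, b, hb, rfl⟩ := IsFractionRing.div_surjective (A := Poly) g
  have hb0 : algebraMap Poly AlgFun b ≠ 0 := by
    rw [IsScalarTower.algebraMap_apply Poly RatFun AlgFun]
    exact (map_ne_zero _).2 (IsFractionRing.to_map_ne_zero_of_mem_nonZeroDivisors hb)
  have h1 : algebraMap RatFun AlgFun (algebraMap Poly RatFun a / algebraMap Poly RatFun b) *
      algebraMap Poly AlgFun b = algebraMap Poly AlgFun a := by
    rw [map_div₀, ← IsScalarTower.algebraMap_apply Poly RatFun AlgFun,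
      ← IsScalarTower.algebraMap_apply Poly RatFun AlgFun, div_mul_cancel₀ _ hb0]
  have h2 := congrArg algDer h1
  rw [Derivation.leibniz, algDer_algebraMap, algDer_algebraMap, smul_eq_mul, smul_eq_mul] at h2
  have h3 := eq_div_of_mul_eq hb0 ((mul_comm _ _).trans (eq_sub_of_add_eq' h2))
  rw [h3]
  exact div_mem (sub_mem (hP _) (mul_mem ⟨_, rfl⟩ (hP _))) (hP _)

theorem exists_denominator {t : AlgFun} (ht : t ∈ (algebraMap RatFun AlgFun).fieldRange) :
    ∃ d : Poly, d ≠ 0 ∧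
      ∀ b, algebraMap Poly AlgFun b * t ∈ (algebraMap Poly AlgFun).range ↔ d ∣ b := by
  obtain ⟨u, rfl⟩ := ht
  refine ⟨IsFractionRing.den Poly u, nonZeroDivisors.coe_ne_zero _, fun b => ?_⟩
  have hd : algebraMap Poly RatFun (IsFractionRing.den Poly u) ≠ 0 :=
    IsFractionRing.to_map_ne_zero_of_mem_nonZeroDivisors (IsFractionRing.den Poly u).2
  have hu : u * algebraMap Poly RatFun (IsFractionRing.den Poly u) =
      algebraMap Poly RatFun (IsFractionRing.num Poly u) := by
    have h := IsFractionRing.mk'_num_den' Poly u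
    rw [div_eq_iff hd] at h
    exact h.symm
  rw [IsScalarTower.algebraMap_eq Poly RatFun AlgFun]
  constructor
  · rintro ⟨c, hc⟩
    simp only [RingHom.comp_apply, ← map_mul] at hc
    have hc' := (algebraMap RatFun AlgFun).injective hc
    have h1 : c * IsFractionRing.den Poly u = b * IsFractionRing.num Poly u := by
      refine IsFractionRing.injective Poly RatFun ?_
      rw [map_mul, map_mul, hc', ← hu]
      ring
    exact (IsFractionRing.num_den_reduced Poly u).symm.dvd_of_dvd_mul_right
      ⟨c, by rw [← h1, mul_comm]⟩
  · rintro ⟨c, rfl⟩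
    refine ⟨c * IsFractionRing.num Poly u, ?_⟩
    simp only [RingHom.comp_apply, ← map_mul]
    congr 1
    rw [map_mul, map_mul, ← hu]
    ring

/-- The cubic system along the first Painlevé equation has no rational solution. -/
theorem not_isCubicSystem_fieldRange {s p q r : AlgFun}
    (hs : s ∈ (algebraMap RatFun AlgFun).fieldRange)
    (hp : p ∈ (algebraMap RatFun AlgFun).fieldRange)
    (hq : q ∈ (algebraMap RatFun AlgFun).fieldRange)
    (hr : r ∈ (algebraMap RatFun AlgFun).fieldRange) :
    ¬ IsCubicSystem algDer (coord 1) 12 s p q r := by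
  intro h
  obtain ⟨ds, ds0, hds⟩ := exists_denominator hs
  obtain ⟨dp, dp0, hdp⟩ := exists_denominator hp
  obtain ⟨dq, dq0, hdq⟩ := exists_denominator hq
  obtain ⟨dr, dr0, hdr⟩ := exists_denominator hr
  let _ := UniqueFactorizationMonoid.toGCDMonoid Poly
  obtain ⟨g, hg⟩ : ∃ g : Poly, ∀ b, g ∣ b ↔ ds ∣ b ∧ dp ∣ b ∧ dq ∣ b ∧ dr ∣ b :=
    ⟨lcm ds (lcm dp (lcm dq dr)), fun b => by simp only [lcm_dvd_iff]⟩
  have hg0 : g ≠ 0 := by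
    rintro rfl
    have h0 := (hg (ds * dp * dq * dr)).2 ⟨⟨dp * dq * dr, by ring⟩, ⟨ds * dq * dr, by ring⟩,
      ⟨ds * dp * dr, by ring⟩, ⟨ds * dp * dq, by ring⟩⟩
    exact mul_ne_zero (mul_ne_zero (mul_ne_zero ds0 dp0) dq0) dr0 (zero_dvd_iff.1 h0)
  obtain ⟨gs, gp, gq, gr⟩ := (hg g).1 dvd_rfl
  rw [← hds] at gs
  rw [← hdp] at gp
  rw [← hdq] at gq
  rw [← hdr] at gr
  have hR (a : Poly) : algebraMap Poly AlgFun a ∈ (algebraMap Poly AlgFun).range := ⟨a, rfl⟩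
  have hy : coord 1 ∈ (algebraMap Poly AlgFun).range := hR _
  have hDR {u : AlgFun} (hu : u ∈ (algebraMap Poly AlgFun).range) :
      algDer u ∈ (algebraMap Poly AlgFun).range := by
    obtain ⟨a, rfl⟩ := hu
    exact ⟨painleveDer a, (algDer_algebraMap a).symm⟩
  -- From `D(g t) - g D t = (D g) t`: the system has polynomial coefficients, so `g` also clears the
  -- denominators of the derivatives, and `D g` is another common denominator.
  have key {t t' : AlgFun} (ht : algebraMap Poly AlgFun g * t ∈ (algebraMap Poly AlgFun).range)
      (htt : algDer t = t')
      (ht' : algebraMap Poly AlgFun g * t' ∈ (algebraMap Poly AlgFun).range) :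
      algebraMap Poly AlgFun (painleveDer g) * t ∈ (algebraMap Poly AlgFun).range := by
    have h1 := sub_mem (hDR ht) ht'
    rw [Derivation.leibniz, htt, algDer_algebraMap, smul_eq_mul, smul_eq_mul] at h1
    convert h1 using 1
    ring
  have h2 : (2 : AlgFun) ∈ (algebraMap Poly AlgFun).range := ofNat_mem _ 2
  have h3 : (3 : AlgFun) ∈ (algebraMap Poly AlgFun).range := ofNat_mem _ 3
  have h12 : (12 : AlgFun) ∈ (algebraMap Poly AlgFun).range := ofNat_mem _ 12
  have h24 : (24 : AlgFun) ∈ (algebraMap Poly AlgFun).range := ofNat_mem _ 24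
  have h36 : (36 : AlgFun) ∈ (algebraMap Poly AlgFun).range := ofNat_mem _ 36
  have hdvd : g ∣ painleveDer g := by
    refine (hg _).2 ⟨(hds _).1 (key gs h.eq_s ?_), (hdp _).1 (key gp h.eq_p ?_),
      (hdq _).1 (key gq h.eq_q ?_), (hdr _).1 (key gr h.eq_r ?_)⟩
    · convert add_mem (mul_mem (mul_mem h36 hy) gp) (mul_mem (hR g) h12) using 1
      ring
    · convert sub_mem gs (mul_mem (mul_mem h24 hy) gq) using 1
      ring
    · convert neg_mem (add_mem (mul_mem h2 gp) (mul_mem (mul_mem h12 hy) gr)) using 1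
      ring
    · convert neg_mem (mul_mem h3 gq) using 1
      ring
  obtain ⟨γ, rfl⟩ := exists_eq_C_of_painleveDer_eq_zero (painleveDer_eq_zero_of_dvd hdvd)
  have hγ : γ ≠ 0 := by
    rintro rfl
    simp at hg0
  have hmem {t : AlgFun} (ht : algebraMap Poly AlgFun (MvPolynomial.C γ) * t ∈
      (algebraMap Poly AlgFun).range) : t ∈ (algebraMap Poly AlgFun).range := by
    have h1 := mul_mem (hR (MvPolynomial.C γ⁻¹)) ht
    rwa [← mul_assoc, ← map_mul, ← MvPolynomial.C_mul, inv_mul_cancel₀ hγ, MvPolynomial.C_1,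
      map_one, one_mul] at h1
  obtain ⟨s', rfl⟩ := hmem gs
  obtain ⟨p', rfl⟩ := hmem gp
  obtain ⟨q', rfl⟩ := hmem gq
  obtain ⟨r', rfl⟩ := hmem gr
  have hinj : Function.Injective (algebraMap Poly AlgFun) := by
    rw [IsScalarTower.algebraMap_eq Poly RatFun AlgFun]
    exact (algebraMap RatFun AlgFun).injective.comp (IsFractionRing.injective Poly RatFun)
  have e2 : algebraMap Poly AlgFun 2 = 2 := map_ofNat _ 2
  have e3 : algebraMap Poly AlgFun 3 = 3 := map_ofNat _ 3
  have e12 : algebraMap Poly AlgFun 12 = 12 := map_ofNat _ 12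
  have e24 : algebraMap Poly AlgFun 24 = 24 := map_ofNat _ 24
  have e36 : algebraMap Poly AlgFun 36 = 36 := map_ofNat _ 36
  refine not_isCubicSystem_polynomial (s := s') (p := p') (q := q') (r := r')
    ⟨hinj ?_, hinj ?_, hinj ?_, hinj ?_⟩
  · rw [← algDer_algebraMap, h.eq_r]
    simp [e3]
  · rw [← algDer_algebraMap, h.eq_q]
    simp [e2, e12, coord]
  · rw [← algDer_algebraMap, h.eq_p]
    simp [e24, coord]
  · rw [← algDer_algebraMap, h.eq_s]
    simp [e36, e12, coord]

theorem IsCubicSystem.add {A : Type*} [CommRing A] [Algebra ℂ A] {D : Derivation ℂ A A}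
    {y f s p q r f' s' p' q' r' : A} (h : IsCubicSystem D y f s p q r)
    (h' : IsCubicSystem D y f' s' p' q' r') :
    IsCubicSystem D y (f + f') (s + s') (p + p') (q + q') (r + r') := by
  constructor <;> simp only [map_add, h.eq_r, h.eq_q, h.eq_p, h.eq_s, h'.eq_r, h'.eq_q, h'.eq_p,
    h'.eq_s] <;> ring

theorem IsCubicSystem.smul {A : Type*} [CommRing A] [Algebra ℂ A] {D : Derivation ℂ A A}
    {y f s p q r : A} (h : IsCubicSystem D y f s p q r) (a : ℂ) :
    IsCubicSystem D y (a • f) (a • s) (a • p) (a • q) (a • r) := by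
  constructor
  · rw [Derivation.map_smul, h.eq_r]
    simp only [Algebra.smul_def]
    ring
  · rw [Derivation.map_smul, h.eq_q]
    simp only [Algebra.smul_def]
    ring
  · rw [Derivation.map_smul, h.eq_p]
    simp only [Algebra.smul_def]
    ring
  · rw [Derivation.map_smul, h.eq_s]
    simp only [Algebra.smul_def]
    ring

theorem IsCubicSystem.algEquiv {s p q r : AlgFun} (h : IsCubicSystem algDer (coord 1) 12 s p q r)
    (σ : AlgFun ≃ₐ[RatFun] AlgFun) :
    IsCubicSystem algDer (coord 1) 12 (σ s) (σ p) (σ q) (σ r) := by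
  have hσ : σ (coord 1) = coord 1 := by
    rw [coord, IsScalarTower.algebraMap_apply Poly RatFun AlgFun, σ.commutes]
  have e2 : σ 2 = 2 := map_ofNat _ 2
  have e3 : σ 3 = 3 := map_ofNat _ 3
  have e12 : σ 12 = 12 := map_ofNat _ 12
  have e24 : σ 24 = 24 := map_ofNat _ 24
  have e36 : σ 36 = 36 := map_ofNat _ 36
  constructor <;> rw [algDer_algEquiv]
  · simp [h.eq_r, e3]
  · simp [h.eq_q, hσ, e2, e12]
  · simp [h.eq_p, hσ, e24]
  · simp [h.eq_s, hσ, e36, e12]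

/-- The cubic system along the first Painlevé equation has no algebraic solution. -/
theorem not_isCubicSystem_algFun {s p q r : AlgFun} :
    ¬ IsCubicSystem algDer (coord 1) 12 s p q r := by
  intro h
  have hr : IsIntegral RatFun r := Algebra.IsIntegral.isIntegral r
  -- Each conjugate of `r` is carried by an automorphism that transports the whole solution; summing
  -- multiplies the forcing by the number of conjugates.
  have hsum (M : Multiset AlgFun) (hM : ∀ a ∈ M, IsConjRoot RatFun a r) :
      ∃ s p q, IsCubicSystem algDer (coord 1) (M.card * 12) s p q M.sum := by
    induction M using Multiset.induction_on with
    | empty => exact ⟨0, 0, 0, by constructor <;> simp⟩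
    | cons a M ih =>
      obtain ⟨s', p', q', h'⟩ := ih fun b hb => hM b (Multiset.mem_cons_of_mem hb)
      obtain ⟨σ, rfl⟩ := (hM a (Multiset.mem_cons_self a M)).exists_algEquiv
      refine ⟨σ s + s', σ p + p', σ q + q', ?_⟩
      have h2 := (h.algEquiv σ).add h'
      rw [Multiset.sum_cons, Multiset.card_cons]
      convert h2 using 1
      push_cast
      ring
  obtain ⟨s', p', q', h'⟩ := hsum ((minpoly RatFun r).aroots AlgFun) fun a ha =>
    ((isConjRoot_iff_mem_minpoly_aroots hr).2 ha).symm
  have hsplit : ((minpoly RatFun r).map (algebraMap RatFun AlgFun)).Splits :=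
    IsAlgClosed.splits _
  have hr' : ((minpoly RatFun r).aroots AlgFun).sum ∈ (algebraMap RatFun AlgFun).fieldRange := by
    have h1 := hsplit.nextCoeff_eq_neg_sum_roots_of_monic ((minpoly.monic hr).map _)
    rw [Polynomial.nextCoeff_map_eq] at h1
    exact neg_mem_iff.1 ⟨_, h1⟩
  have hcard : (((minpoly RatFun r).aroots AlgFun).card : ℂ) ≠ 0 := by
    rw [Nat.cast_ne_zero, ← Nat.pos_iff_ne_zero, Multiset.card_pos_iff_exists_mem]
    exact ⟨r, (isConjRoot_iff_mem_minpoly_aroots hr).1 IsConjRoot.refl⟩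
  set n := ((minpoly RatFun r).aroots AlgFun).card
  set r' := ((minpoly RatFun r).aroots AlgFun).sum
  have hmem {a b : AlgFun} (c : RatFun) (hc : c ≠ 0)
      (hb : b ∈ (algebraMap RatFun AlgFun).fieldRange)
      (hab : algebraMap RatFun AlgFun c * a = b) :
      a ∈ (algebraMap RatFun AlgFun).fieldRange := by
    have hc' : algebraMap RatFun AlgFun c ≠ 0 := (map_ne_zero _).2 hc
    rw [eq_div_of_mul_eq hc' ((mul_comm _ _).trans hab)]
    exact div_mem hb ⟨c, rfl⟩
  have hy : coord 1 ∈ (algebraMap RatFun AlgFun).fieldRange :=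
    ⟨algebraMap Poly RatFun (.X 1), (IsScalarTower.algebraMap_apply Poly RatFun AlgFun _).symm⟩
  have e2 : algebraMap RatFun AlgFun 2 = 2 := map_ofNat _ 2
  have e3 : algebraMap RatFun AlgFun 3 = 3 := map_ofNat _ 3
  -- Only the sum of the conjugates of `r` is known to be rational; the system yields the other
  -- three entries by differentiation.
  have hq' := hmem (a := q') (-3) (by norm_num) (algDer_mem_fieldRange hr') (by
    rw [h'.eq_r, map_neg, e3])
  have hp' := hmem (a := p') (-2) (by norm_num) (add_mem (algDer_mem_fieldRange hq')
    (mul_mem (mul_mem (ofNat_mem _ 12) hy) hr')) (by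
      rw [h'.eq_q, map_neg, e2]; ring)
  have hs' := hmem (a := s') 1 one_ne_zero (add_mem (algDer_mem_fieldRange hp')
    (mul_mem (mul_mem (ofNat_mem _ 24) hy) hq')) (by rw [h'.eq_p]; simp)
  have hsm {a : AlgFun} (ha : a ∈ (algebraMap RatFun AlgFun).fieldRange) :
      (n : ℂ)⁻¹ • a ∈ (algebraMap RatFun AlgFun).fieldRange := by
    obtain ⟨b, rfl⟩ := ha
    exact ⟨(n : ℂ)⁻¹ • b, by
      rw [Algebra.smul_def, Algebra.smul_def, map_mul, ← IsScalarTower.algebraMap_apply]⟩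
  refine not_isCubicSystem_fieldRange (hsm hs') (hsm hp') (hsm hq') (hsm hr') ?_
  have h3 := h'.smul (n : ℂ)⁻¹
  convert h3 using 1
  rw [Algebra.smul_def, ← mul_assoc, ← map_natCast (algebraMap ℂ AlgFun) n, ← map_mul,
    inv_mul_cancel₀ hcard, map_one, one_mul]

/-! ### From an `asl₂` sequence to the cubic system. -/

theorem partialDeriv_comm (i j : Fin 3) (f : AlgFun) :
    partialDeriv i (partialDeriv j f) = partialDeriv j (partialDeriv i f) := by
  have h : ⁅partialDeriv i, partialDeriv j⁆ = (0 : Derivation ℂ AlgFun AlgFun) :=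
    derivation_algFun_ext fun k => by
      rw [Derivation.commutator_apply, partialDeriv_coord, partialDeriv_coord]
      split_ifs <;> simp
  have h1 := congrArg (fun d => d f) h
  simp only [Derivation.commutator_apply] at h1
  exact sub_eq_zero.1 h1

theorem matrix_map_derivation_mul (D : Derivation ℂ AlgFun AlgFun)
    (A B : Matrix (Fin 2) (Fin 2) AlgFun) :
    (A * B).map D = A.map D * B + A * B.map D := by
  ext i j
  simp only [Matrix.map_apply, Matrix.mul_apply, Matrix.add_apply, map_sum, Derivation.leibniz,
    smul_eq_mul, ← Finset.sum_add_distrib]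
  exact Finset.sum_congr rfl fun k _ => by ring

/-- The gauge transform of a flat connection is flat. -/
theorem flat_of_gauge {P : Matrix (Fin 2) (Fin 2) AlgFun} (hP : IsUnit P)
    {B G : Fin 3 → Matrix (Fin 2) (Fin 2) AlgFun}
    (hB : ∀ i j, (B j).map (partialDeriv i) - (B i).map (partialDeriv j) = B i * B j - B j * B i)
    (hG : ∀ i, P * G i = B i * P - P.map (partialDeriv i)) (i j : Fin 3) :
    (G j).map (partialDeriv i) - (G i).map (partialDeriv j) = G i * G j - G j * G i := by
  refine hP.mul_left_cancel ?_
  have h (i j : Fin 3) : P.map (partialDeriv i) * G j + P * (G j).map (partialDeriv i) =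
      (B j).map (partialDeriv i) * P + B j * P.map (partialDeriv i) -
        (P.map (partialDeriv j)).map (partialDeriv i) := by
    rw [← matrix_map_derivation_mul, ← matrix_map_derivation_mul, hG]
    exact Matrix.map_sub _ (map_sub _) _ _
  have hPP : (P.map (partialDeriv j)).map (partialDeriv i) =
      (P.map (partialDeriv i)).map (partialDeriv j) := by
    ext a b
    exact partialDeriv_comm i j (P a b)
  have hd (i : Fin 3) : P.map (partialDeriv i) = B i * P - P * G i := by rw [hG]; abel
  have h1 := h i j
  have h2 := h j i
  rw [hPP] at h1
  generalize (P.map (partialDeriv i)).map (partialDeriv j) = W at h1 h2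
  rw [hd i] at h1
  rw [hd j] at h2
  have h3 : (B j).map (partialDeriv i) = (B i).map (partialDeriv j) + B i * B j - B j * B i := by
    rw [add_sub_assoc, ← hB]; abel
  rw [h3] at h1
  rw [mul_sub, eq_sub_of_add_eq' h1, eq_sub_of_add_eq' h2]
  noncomm_ring

/-- A flat torsion-free connection extending the linearized first Painlevé equation yields a
solution of the cubic system. -/
theorem exists_isCubicSystem_of_flat {G : Fin 3 → Matrix (Fin 2) (Fin 2) AlgFun}
    (hflat : ∀ i j,
      (G j).map (partialDeriv i) - (G i).map (partialDeriv j) = G i * G j - G j * G i)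
    (htor : ∀ a, G 1 a 1 = G 2 a 0)
    (hX : G 0 + coord 2 • G 1 + (6 * coord 1 ^ 2 + coord 0) • G 2 = !![0, 1; 12 * coord 1, 0]) :
    ∃ s p q r, IsCubicSystem algDer (coord 1) 12 s p q r := by
  have hf (i j : Fin 3) (a b : Fin 2) : partialDeriv i (G j a b) - partialDeriv j (G i a b) =
      G i a 0 * G j 0 b + G i a 1 * G j 1 b - (G j a 0 * G i 0 b + G j a 1 * G i 1 b) := by
    have h := congrFun (congrFun (hflat i j) a) b
    simpa only [Matrix.sub_apply, Matrix.map_apply, Matrix.mul_apply, Fin.sum_univ_two] using h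
  have h0 (a b : Fin 2) : G 0 a b = !![0, 1; 12 * coord 1, 0] a b - coord 2 * G 1 a b -
      (6 * coord 1 ^ 2 + coord 0) * G 2 a b := by
    rw [← hX]
    simp only [Matrix.add_apply, Matrix.smul_apply, smul_eq_mul]
    ring
  -- Flatness contracted with `X₁`, after `hX` has eliminated `G 0`, is a linear equation for `G j`
  -- along the field.
  have hD (j : Fin 3) (a b : Fin 2) : algDer (G j a b) =
      partialDeriv j (!![0, 1; 12 * coord 1, 0] a b) - partialDeriv j (coord 2) * G 1 a b -
      partialDeriv j (6 * coord 1 ^ 2 + coord 0) * G 2 a b +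
      (!![0, 1; 12 * coord 1, 0] a 0 * G j 0 b + !![0, 1; 12 * coord 1, 0] a 1 * G j 1 b -
        (G j a 0 * !![0, 1; 12 * coord 1, 0] 0 b + G j a 1 * !![0, 1; 12 * coord 1, 0] 1 b)) := by
    have h1 := hf 0 j a b
    rw [h0 a b, h0 a 0, h0 a 1, h0 0 b, h0 1 b] at h1
    simp only [map_sub, Derivation.leibniz, smul_eq_mul] at h1
    rw [algDer_apply]
    linear_combination h1 + coord 2 * hf 1 j a b + (6 * coord 1 ^ 2 + coord 0) * hf 2 j a b
  have d2 (j : Fin 3) : partialDeriv j (6 * coord 1 ^ 2 + coord 0) =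
      12 * coord 1 * partialDeriv j (coord 1) + partialDeriv j (coord 0) := by
    rw [map_add, Derivation.leibniz, Derivation.leibniz_pow, derivation_ofNat]
    simp only [smul_eq_mul, nsmul_eq_mul]
    push_cast
    ring
  have d12 (j : Fin 3) : partialDeriv j (12 * coord 1) = 12 * partialDeriv j (coord 1) := by
    rw [Derivation.leibniz, derivation_ofNat]
    simp only [smul_eq_mul]
    ring
  have hs := hD 1 1 0
  have hp := hD 1 0 0
  have hq := hD 1 0 1
  have ht := hD 1 1 1
  have hu := hD 2 1 1
  have hr := hD 2 0 1
  have t0 := htor 0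
  have t1 := htor 1
  simp only [d2, partialDeriv_coord, Matrix.of_apply, Matrix.cons_val_zero, Matrix.cons_val_one,
    Matrix.cons_val', map_zero, d12, Derivation.map_one_eq_zero] at hs hp hq ht hu hr
  simp only [Fin.isValue, Fin.reduceEq, if_true, if_false] at hs hp hq ht hu hr
  have e3 : (3 : AlgFun) ≠ 0 := three_ne_zero
  -- These are the middle coefficients of the cubic `ω(v, G(v, v)) = s v₁³ - 3p v₁² v₂ - 3q v₁ v₂² -
  -- r v₂³`.
  obtain ⟨p', hp'⟩ : ∃ p', 3 * p' = G 1 0 0 - 2 * G 1 1 1 := ⟨_, mul_div_cancel₀ _ e3⟩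
  obtain ⟨q', hq'⟩ : ∃ q', 3 * q' = 2 * G 1 0 1 - G 2 1 1 := ⟨_, mul_div_cancel₀ _ e3⟩
  have dp := congrArg algDer hp'
  have dq := congrArg algDer hq'
  simp only [map_sub, Derivation.leibniz, derivation_ofNat, smul_eq_mul, mul_zero,
    add_zero] at dp dq
  refine ⟨G 1 1 0, p', q', G 2 0 1, ?_, mul_left_cancel₀ e3 ?_, mul_left_cancel₀ e3 ?_, ?_⟩
  · linear_combination hr + t0 + hq'
  · linear_combination dq + 2 * hq - hu + 2 * hp' - t1
  · linear_combination dp + hp - 2 * ht + 24 * coord 1 * hq' + 12 * coord 1 * t0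
  · linear_combination hs - 12 * coord 1 * hp' + 12 * coord 1 * t1

/-- The foliation of the first Painlevé equation has no Godbillon–Vey sequence of type `asl₂`: the
matrix of such a sequence, in the frame given by the forms of the foliation, is a flat torsion-free
connection extending the linearized first Painlevé equation. -/
theorem not_isAslTwoSequence (Ω₀ : Fin 2 → OneForm) (Ω₁ : Matrix (Fin 2) (Fin 2) OneForm) :
    ¬ IsAslTwoSequence painleveOne Ω₀ Ω₁ := by
  intro h
  let P : Matrix (Fin 2) (Fin 2) AlgFun := .of fun a j => Ω₀ a j.succ
  let B (i : Fin 3) : Matrix (Fin 2) (Fin 2) AlgFun := .of fun a b => Ω₁ a b i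
  have hP0 (a : Fin 2) :
      Ω₀ a 0 = -(P a 0 * coord 2 + P a 1 * (6 * coord 1 ^ 2 + coord 0)) := by
    have h1 := (h.defines painleveOne).2 ⟨1, (one_smul _ _).symm⟩ a
    simp only [contract, painleveOne, Fin.sum_univ_three, Matrix.cons_val_zero,
      Matrix.cons_val_one, Matrix.cons_val] at h1
    change Ω₀ a 0 = -(Ω₀ a 1 * coord 2 + Ω₀ a 2 * (6 * coord 1 ^ 2 + coord 0))
    linear_combination h1
  -- A kernel vector would give a vector field without `∂/∂x` part killed by both forms; being a
  -- multiple of `X₁`, it vanishes.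
  have hdet : P.det ≠ 0 := by
    intro h0
    obtain ⟨v, hv, hPv⟩ := Matrix.exists_mulVec_eq_zero_iff.2 h0
    obtain ⟨f, hf⟩ := (h.defines (Fin.cons 0 v)).1 fun a => by
      have h1 := congrFun hPv a
      simp only [contract, Fin.sum_univ_succ (n := 2), Fin.cons_zero, Fin.cons_succ, mul_zero,
        zero_add]
      exact h1
    have hf0 : f = 0 := by simpa [painleveOne] using (congrFun hf 0).symm
    refine hv (funext fun j => ?_)
    have h1 := congrFun hf j.succ
    rwa [hf0, zero_smul, Fin.cons_succ] at h1
  have hP : IsUnit P := (Matrix.isUnit_iff_isUnit_det P).2 hdet.isUnit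
  let G (i : Fin 3) := P⁻¹ * (B i * P - P.map (partialDeriv i))
  have hG (i : Fin 3) : P * G i = B i * P - P.map (partialDeriv i) :=
    Matrix.mul_nonsing_inv_cancel_left _ _ hdet.isUnit
  have hB (i j : Fin 3) : (B j).map (partialDeriv i) - (B i).map (partialDeriv j) =
      B i * B j - B j * B i := by
    ext a b
    have h1 := congrFun (congrFun (h.structure_one a b) i) j
    simp only [dForm, wedge, Finset.sum_apply, Finset.sum_sub_distrib] at h1
    simpa only [Matrix.sub_apply, Matrix.map_apply, Matrix.mul_apply, B, Matrix.of_apply] using h1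
  have hGe (i : Fin 3) (a b : Fin 2) : P a 0 * G i 0 b + P a 1 * G i 1 b =
      Ω₁ a 0 i * P 0 b + Ω₁ a 1 i * P 1 b - partialDeriv i (P a b) := by
    have h1 := congrFun (congrFun (hG i) a) b
    simpa only [Matrix.sub_apply, Matrix.map_apply, Matrix.mul_apply, Fin.sum_univ_two, B,
      Matrix.of_apply] using h1
  have hS (i j : Fin 3) (a : Fin 2) : partialDeriv i (Ω₀ a j) - partialDeriv j (Ω₀ a i) =
      Ω₁ a 0 i * Ω₀ 0 j - Ω₁ a 0 j * Ω₀ 0 i + (Ω₁ a 1 i * Ω₀ 1 j - Ω₁ a 1 j * Ω₀ 1 i) := by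
    have h1 := congrFun (congrFun (h.structure_zero a) i) j
    simpa only [dForm, wedge, Finset.sum_apply, Fin.sum_univ_two] using h1
  have hinj {u v : Fin 2 → AlgFun}
      (huv : ∀ a, P a 0 * u 0 + P a 1 * u 1 = P a 0 * v 0 + P a 1 * v 1) : u = v := by
    refine Matrix.mulVec_injective_of_isUnit hP (funext fun a => ?_)
    simpa only [Matrix.mulVec, dotProduct, Fin.sum_univ_two] using huv a
  have htor (a : Fin 2) : G 1 a 1 = G 2 a 0 := by
    refine congrFun (hinj (u := fun a => G 1 a 1) (v := fun a => G 2 a 0) fun a => ?_) a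
    have h1 : partialDeriv 1 (P a 1) - partialDeriv 2 (P a 0) =
      Ω₁ a 0 1 * P 0 1 - Ω₁ a 0 2 * P 0 0 + (Ω₁ a 1 1 * P 1 1 - Ω₁ a 1 2 * P 1 0) := hS 1 2 a
    linear_combination hGe 1 a 1 - hGe 2 a 0 - h1
  -- The structure equation contracted with `X₁`: differentiating `Ω₀ a 0`, as given by `hP0`,
  -- brings in the Jacobian of `(y', 6y² + x)`.
  have hX (j : Fin 2) : (fun b => G 0 b j + coord 2 * G j.succ b 0 +
      (6 * coord 1 ^ 2 + coord 0) * G j.succ b 1) =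
      ![partialDeriv j.succ (coord 2), partialDeriv j.succ (6 * coord 1 ^ 2 + coord 0)] := by
    refine hinj fun a => ?_
    have h1 : partialDeriv 0 (P a j) - partialDeriv j.succ (Ω₀ a 0) =
      Ω₁ a 0 0 * P 0 j - Ω₁ a 0 j.succ * Ω₀ 0 0 +
        (Ω₁ a 1 0 * P 1 j - Ω₁ a 1 j.succ * Ω₀ 1 0) := hS 0 j.succ a
    rw [hP0, hP0 0, hP0 1, map_neg, map_add, Derivation.leibniz, Derivation.leibniz] at h1
    simp only [smul_eq_mul] at h1
    simp only [Matrix.cons_val_zero, Matrix.cons_val_one]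
    linear_combination hGe 0 a j + coord 2 * hGe j.succ a 0 +
      (6 * coord 1 ^ 2 + coord 0) * hGe j.succ a 1 - h1
  have d1 : partialDeriv 1 (6 * coord 1 ^ 2 + coord 0) = 12 * coord 1 := by
    rw [map_add, Derivation.leibniz, Derivation.leibniz_pow, derivation_ofNat, partialDeriv_coord,
      partialDeriv_coord]
    simp
    ring
  have d2 : partialDeriv 2 (6 * coord 1 ^ 2 + coord 0) = 0 := by
    rw [map_add, Derivation.leibniz, Derivation.leibniz_pow, derivation_ofNat, partialDeriv_coord,
      partialDeriv_coord]
    simp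
  obtain ⟨s, p, q, r, hc⟩ := exists_isCubicSystem_of_flat (flat_of_gauge hP hB hG) htor (by
    ext b j
    fin_cases j
    · have h1 := congrFun (hX 0) b
      simp only [Fin.succ_zero_eq_one, d1, partialDeriv_coord] at h1
      fin_cases b
      · simpa [htor] using h1
      · simpa [htor] using h1
    · have h1 := congrFun (hX 1) b
      simp only [Fin.succ_one_eq_two, d2, partialDeriv_coord] at h1
      fin_cases b
      · simpa [htor] using h1
      · simpa [htor] using h1)
  exact not_isCubicSystem_algFun hc

end PainleveFoliation
end

theorem proposition2p3 :
    ¬ ∃ (Ω₀ : Fin 2 → PainleveFoliation.OneForm)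
        (Ω₁ : Matrix (Fin 2) (Fin 2) PainleveFoliation.OneForm),
      PainleveFoliation.IsAslTwoSequence PainleveFoliation.painleveOne Ω₀ Ω₁ := by
  rintro ⟨Ω₀, Ω₁, h⟩
  exact PainleveFoliation.not_isAslTwoSequence Ω₀ Ω₁ h
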